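/- **Setting.** Let $\alpha\in(0,1)$ and $\beta>0$. For $N\ge 1$ let $\mathbf J=(J_{ij})_{1\le i<j\le N}$ be i.i.d. with density $\frac{\alpha}{2N}|x|^{-(1+\alpha)}\mathbf 1\{|x|\ge N^{-1/\alpha}\}$, with law $\mathbb P_{\mathbf J}$, and let $H_{\mathbf J}(\sigma)=\sum_{i<j}J_{ij}\sigma_i\sigma_j$ and $\pi_{\beta,\mathbf J}(\sigma)\propto e^{\beta H_{\mathbf J}(\sigma)}$ on $\{\pm1\}^N$. Glauber dynamics is the continuous-time Markov chain in which every vertex has a rate-$1$ Poisson clock, and when the clock of $v$ rings the spin at $v$ is resampled from its $\pi_{\beta,\mathbf J}$-conditional law given all the other spins. For $a>0$ and $\gamma$ let $E_{a,\gamma}=\{(i,j): i<j,\ |J_{ij}|\ge \frac{a}{2\beta}N^\gamma\}$ and $K=|E_{a,\gamma}|$. **Theorem.** For all $\alpha\in(0,1)$ and $\beta>0$ there is $D=D(\alpha,\beta)>0$ such that for every $a>0$ and every $\gamma\in\left(\frac1{2\alpha}+\frac1{1+\alpha},\frac1\alpha\right)$ there are (measurable) events $G_N$ with $\mathbb P_{\mathbf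 J}(G_N)\to1$ as $N\to\infty$, such that for every $N$ and every $\mathbf J\in G_N$ the following holds. The numbers $|J_{ij}|$, $i<j$, are pairwise distinct, so that the bonds have a unique enumeration $e_1,e_2,\dots,e_{\binom N2}$, $e_l=(v_l,w_l)$, with $|J_{(1)}|>|J_{(2)}|>\dots>|J_{(\binom N2)}|$, where $J_{(l)}=J_{e_l}$; moreover $K<\binom N2$, and the bonds in $E_{a,\gamma}=\{e_1,\dots,e_K\}$ are pairwise vertex-disjoint. For every $0\le L\le K$ and every assignment of spins to the vertices $\{v_i,w_i\}_{i\le L}$, let $\mathcal C$ be the set of all configurations in $\{\pm1\}^N$ that take these values there. Let $\overline X(t)$ be Glauber dynamics restricted to $\mathcal C$, i.e. started in $\mathcal C$ and rejecting all updates at the vertices $\{v_i,w_i\}_{i\le L}$, and let $$t_{\mathsf{mix}}^{\mathcal C}=\inf\Big\{t>0:\ \max_{x\in\mathcal C} d_{\mathrm{TV}}\big(\mathbb P_x(\overline X(t)\in\cdot),\ \pi_{\beta,\mathbf J}(\cdot\mid\mathcal C)\big)<\tfrac14\Big\}.$$ Then $$t_{\mathsf{mix}}^{\mathcal C}\le \exp\Big(2\beta|J_{(L+1)}|+D\,N^{\frac12+\frac1{2\alpha}}\Big).$$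 -/

import Mathlib

open Filter Topology MeasureTheory
open scoped ENNReal

noncomputable section

namespace LevyGlass

/-- The pairs `i < j` of vertices in `Fin N` (the bonds). -/
abbrev Bond (N : ℕ) : Type := {p : Fin N × Fin N // p.1 < p.2}

/-- A realization of the couplings `(J_{ij})_{i<j}`. -/
abbrev Couplings (N : ℕ) : Type := Bond N → ℝ

/-- Spin configurations `{±1}^N`; the unit group `ℤˣ` is `{1, -1}`. -/
abbrev Config (N : ℕ) : Type := Fin N → ℤˣ

/-- The numerical value `±1` of a spin. -/
def spin (s : ℤˣ) : ℝ := ((s : ℤ) : ℝ)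

/-- The heavy-tailed law of one coupling, with density
`α / (2 N) * |x| ^ (-(1 + α))` on `|x| ≥ N ^ (-1/α)`. -/
def couplingLaw (α : ℝ) (N : ℕ) : Measure ℝ :=
  volume.withDensity fun x =>
    ENNReal.ofReal
      (if (N : ℝ) ^ (-(1 / α)) ≤ |x| then α / (2 * (N : ℝ)) * |x| ^ (-(1 + α)) else 0)

/-- The law of the i.i.d. couplings `(J_{ij})_{i<j}`. -/
def disorderLaw (α : ℝ) (N : ℕ) : Measure (Couplings N) :=
  Measure.pi fun _ => couplingLaw α N

/-- The Hamiltonian `H_J(σ) = ∑_{i<j} J_{ij} σ_i σ_j`. -/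
def hamiltonian {N : ℕ} (J : Couplings N) (σ : Config N) : ℝ :=
  ∑ b : Bond N, J b * spin (σ b.1.1) * spin (σ b.1.2)

/-- The Gibbs measure `π_{β,J}(σ) ∝ exp (β H_J(σ))`, as a mass function. -/
def gibbs {N : ℕ} (β : ℝ) (J : Couplings N) (σ : Config N) : ℝ :=
  Real.exp (β * hamiltonian J σ) / ∑ τ : Config N, Real.exp (β * hamiltonian J τ)

/-- The Gibbs measure conditioned on a set `C` of configurations. -/
def gibbsOn {N : ℕ} (β : ℝ) (J : Couplings N) (C : Finset (Config N)) (σ : Config N) : ℝ :=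
  if σ ∈ C then gibbs β J σ / ∑ τ ∈ C, gibbs β J τ else 0

/-- The kernel that resamples the spin at `v` from its conditional Gibbs law given all the
other spins, which are kept. -/
def resampleKernel {N : ℕ} (β : ℝ) (J : Couplings N) (v : Fin N) :
    Matrix (Config N) (Config N) ℝ :=
  Matrix.of fun σ τ =>
    if ∀ w, w ≠ v → τ w = σ w then
      gibbs β J τ / ∑ s : ℤˣ, gibbs β J (Function.update σ v s)
    else 0

/-- The generator of Glauber dynamics that rejects all updates at the vertices of `F`: each
vertex has a rate-one Poisson clock; when the clock of `v` rings, nothing happens if `v ∈ F`,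
and otherwise the spin at `v` is resampled. -/
def glauberGenerator {N : ℕ} (β : ℝ) (J : Couplings N) (F : Finset (Fin N)) :
    Matrix (Config N) (Config N) ℝ :=
  ∑ v : Fin N, ((if v ∈ F then 1 else resampleKernel β J v) - 1)

/-- The total-variation distance between two mass functions on a finite set. -/
def tvDist {S : Type*} [Fintype S] (p q : S → ℝ) : ℝ :=
  (1 / 2) * ∑ x, |p x - q x|

/-- The `ε`-mixing time to `π`, from the worst initial state in `C`, of the continuous-time
Markov chain with generator `Q`; the law at time `t` of the chain started from `x` is the
row `x` of `exp (t Q)`. It is `⊤` if the distance never drops below `ε`. -/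
def mixingTime {S : Type*} [Fintype S] [DecidableEq S] (Q : Matrix S S ℝ) (C : Finset S)
    (π : S → ℝ) (ε : ℝ) : ℝ≥0∞ :=
  sInf {T : ℝ≥0∞ | ∃ t : ℝ, 0 < t ∧ T = ENNReal.ofReal t ∧
    ∀ x ∈ C, tvDist (fun y => NormedSpace.exp (t • Q) x y) π < ε}

/-- The set `E_{a,γ}` of bonds with `|J_{ij}| ≥ a / (2 β) * N ^ γ`. -/
def largeBonds {N : ℕ} (β a γ : ℝ) (J : Couplings N) : Finset (Bond N) :=
  Finset.univ.filter fun b => a / (2 * β) * (N : ℝ) ^ γ ≤ |J b|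

/-- Two bonds have no vertex in common. -/
def VertexDisjoint {N : ℕ} (b c : Bond N) : Prop :=
  b.1.1 ≠ c.1.1 ∧ b.1.1 ≠ c.1.2 ∧ b.1.2 ≠ c.1.1 ∧ b.1.2 ≠ c.1.2

/-- The endpoints of the first `L` bonds `e 0, …, e (L - 1)` of an enumeration. -/
def topVertices {N : ℕ} (e : Fin (N.choose 2) ≃ Bond N) (L : ℕ) : Finset (Fin N) :=
  Finset.univ.filter fun v =>
    ∃ k : Fin (N.choose 2), (k : ℕ) < L ∧ (v = (e k).1.1 ∨ v = (e k).1.2)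

/-- The configurations that agree with `η` on `F`. -/
def frozenSet {N : ℕ} (F : Finset (Fin N)) (η : Config N) : Finset (Config N) :=
  Finset.univ.filter fun σ => ∀ v ∈ F, σ v = η v

/-- The mixing time (to total-variation distance `1/4`) of Glauber dynamics restricted to the
configurations that agree with `η` on `F`. -/
def restrictedMixingTime {N : ℕ} (β : ℝ) (J : Couplings N) (F : Finset (Fin N))
    (η : Config N) : ℝ≥0∞ :=
  mixingTime (glauberGenerator β J F) (frozenSet F η) (gibbsOn β J (frozenSet F η)) (1 / 4)

end LevyGlass

end

/-!
The mixing time is bounded through a Poincaré inequality: for a reversible chain with Poincaré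
constant `Λ` on the class `C`, the chi-square distance to equilibrium decays like
`exp (-2 t / Λ)` (`tvDist_lt_of_poincare`), and the smallest Gibbs weight costs only
a polynomial factor in the mixing time, because all couplings are polynomially bounded in `N` with
high probability. Since `1/2 + 1/(2α) > 1`, factors exponential in `N` are negligible, so that the
canonical-path bound on `Λ` needs no careful congestion count: it suffices to join any two
configurations `σ, τ` by single spin flips such that every `z` on the path has a partner `z'` in `C`
with `H σ + H τ - H z - H z' ≤ 2 m + 4 R`, where `m` is the largest weight of a free bond and
`R = O(N ^ (1/2 + 1/(2α)))` (`exists_energy_barrier`, `gibbsOn_mul_gibbsOn_le`,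
`poincare_restricted`).

For the path, split the bonds into a matching `M`, which carries the large weights, and the rest,
of total weight `R`. Change the spins of `σ` into those of `τ` one vertex at a time, in an order
where the two endpoints of each bond of `M` are neighbours. At any time at most one bond of `M` is
cut. The partner `z'` follows the reversed path, taken just before or just after that bond is cut,
whichever has the larger bond energy there; the defect is then at most `2 m` from the cut bond,
zero from the other bonds of `M`, and at most `4 R` from the rest.

For the matching, take the bonds of weight at least `s = N ^ (1/(2α))` and remove the lighter bond
of every adjacent pair (`exists_matching`). The bonds below `s` have total weight of order
`N * s ^ (1 - α) = N ^ (1/2 + 1/(2α))`, by Chebyshev's inequality (`disorderLaw_small_sum`). The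
expected number of adjacent pairs above `s` is bounded, so there are at most `N ^ (1/4)` of them,
and none lies above `N ^ (1/4) * s`, with high probability; hence the removed bonds also have total
weight at most `N ^ (1/2 + 1/(2α))`.
-/

namespace LevyGlass

/-! ### Reversible chains and the Poincaré inequality -/

section Chain

variable {S : Type*} [Fintype S]

/-- The data for the `L²` theory of a reversible chain on the class `C`: `Q` has zero row sums, no
transitions between `C` and its complement, and is in detailed balance with `π`, a probability
mass function whose support is `C`. -/
structure ReversibleOn (Q : Matrix S S ℝ) (C : Finset S) (π : S → ℝ) : Prop where
  row_sum : ∀ x, ∑ y, Q x y = 0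
  off_diag_nonneg : ∀ x y, x ≠ y → 0 ≤ Q x y
  closed : ∀ x y, Q x y ≠ 0 → (x ∈ C ↔ y ∈ C)
  balance : ∀ x y, π x * Q x y = π y * Q y x
  pos : ∀ x ∈ C, 0 < π x
  zero : ∀ x, x ∉ C → π x = 0
  sum_one : ∑ x, π x = 1

/-- The derivative identity behind the spectral-gap bound, from row sums zero and detailed
balance. -/
lemma two_mul_sum_balance {Q : Matrix S S ℝ} {C : Finset S} {π : S → ℝ}
    (h : ReversibleOn Q C π) (f : S → ℝ) :
    2 * ∑ y, f y * ∑ z, π z * f z * Q z y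
      = -∑ z, ∑ y, π z * Q z y * (f z - f y) ^ 2 := by
  have h1 : ∑ z, ∑ y, π z * Q z y * f z ^ 2 = 0 := by
    refine Finset.sum_eq_zero fun z _ => ?_
    rw [← Finset.sum_mul, ← Finset.mul_sum, h.row_sum]; simp
  have h2 : ∑ z, ∑ y, π z * Q z y * f y ^ 2 = 0 := by
    rw [Finset.sum_comm, ← h1]
    refine Finset.sum_congr rfl fun z _ => Finset.sum_congr rfl fun y _ => ?_
    rw [h.balance]
  have h3 : ∑ y, f y * ∑ z, π z * f z * Q z y = ∑ z, ∑ y, π z * Q z y * (f z * f y) := by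
    rw [Finset.sum_comm]
    refine Finset.sum_congr rfl fun y _ => ?_
    rw [Finset.mul_sum]
    exact Finset.sum_congr rfl fun z _ => by ring
  have h4 : ∑ z, ∑ y, π z * Q z y * (f z - f y) ^ 2
      = ∑ z, ∑ y, π z * Q z y * f z ^ 2 + ∑ z, ∑ y, π z * Q z y * f y ^ 2
        - 2 * ∑ z, ∑ y, π z * Q z y * (f z * f y) := by
    simp only [Finset.mul_sum, ← Finset.sum_add_distrib, ← Finset.sum_sub_distrib]
    exact Finset.sum_congr rfl fun z _ => Finset.sum_congr rfl fun y _ => by ring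
  rw [h4, h1, h2, h3]; ring

lemma sum_sum_sq_sub {C : Finset S} {π : S → ℝ} {Q : Matrix S S ℝ}
    (h : ReversibleOn Q C π) (f : S → ℝ) (hf : ∑ x, π x * f x = 0) :
    ∑ x, ∑ y, π x * π y * (f x - f y) ^ 2 = 2 * ∑ x, π x * f x ^ 2 := by
  have : ∀ x, ∑ y, π x * π y * (f x - f y) ^ 2
      = π x * f x ^ 2 * ∑ y, π y + π x * ∑ y, π y * f y ^ 2
        - 2 * (π x * f x) * ∑ y, π y * f y := by
    intro x
    simp only [Finset.mul_sum, ← Finset.sum_add_distrib, ← Finset.sum_sub_distrib]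
    exact Finset.sum_congr rfl fun y _ => by ring
  simp only [this, hf, h.sum_one, mul_one, mul_zero, sub_zero]
  rw [Finset.sum_add_distrib, ← Finset.sum_mul, h.sum_one]; ring

variable [DecidableEq S]

lemma hasDerivAt_exp_smul_apply (Q : Matrix S S ℝ) (t : ℝ) (x y : S) :
    HasDerivAt (fun u : ℝ => NormedSpace.exp (u • Q) x y)
      (∑ z, NormedSpace.exp (t • Q) x z * Q z y) t := by
  have h : HasDerivAt (fun u : ℝ => NormedSpace.exp (u • Q))
      (NormedSpace.exp (t • Q) * Q) t := by
    open scoped Matrix.Norms.Operator in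
    exact hasDerivAt_exp_smul_const Q t
  have h2 := (hasDerivAt_pi.1 ((hasDerivAt_pi.1 h) x)) y
  simpa [Matrix.mul_apply] using h2

/-- The chain started in `C` stays in `C`: the diagonal projection onto `C` commutes with `Q`,
hence with its exponential. -/
lemma exp_apply_eq_zero {Q : Matrix S S ℝ} {C : Finset S} {π : S → ℝ}
    (h : ReversibleOn Q C π) (t : ℝ) {x y : S} (hx : x ∈ C) (hy : y ∉ C) :
    NormedSpace.exp (t • Q) x y = 0 := by
  set P : Matrix S S ℝ := Matrix.diagonal fun z => if z ∈ C then 1 else 0 with hP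
  have hc : Commute P (t • Q) := by
    refine Commute.smul_right ?_ t
    ext a b
    simp only [hP, Matrix.diagonal_mul, Matrix.mul_diagonal]
    by_cases hab : Q a b = 0
    · simp [hab]
    · have := h.closed a b hab
      simp [this]
  have he : Commute P (NormedSpace.exp (t • Q)) := by
    open scoped Matrix.Norms.Operator in
    exact hc.exp_right
  have := congrFun (congrFun he.eq x) y
  simp only [hP, Matrix.diagonal_mul, Matrix.mul_diagonal] at this
  simpa [hx, hy] using this

lemma sum_exp_apply {Q : Matrix S S ℝ} {C : Finset S} {π : S → ℝ}
    (h : ReversibleOn Q C π) (t : ℝ) (x : S) :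
    ∑ y, NormedSpace.exp (t • Q) x y = 1 := by
  have hd : ∀ s : ℝ, HasDerivAt (fun u : ℝ => ∑ y, NormedSpace.exp (u • Q) x y) 0 s := by
    intro s
    have := HasDerivAt.fun_sum (u := Finset.univ)
      fun y _ => hasDerivAt_exp_smul_apply Q s x y
    refine this.congr_deriv ?_
    rw [Finset.sum_comm]
    simp [← Finset.mul_sum, h.row_sum]
  have hc := is_const_of_deriv_eq_zero (fun s => (hd s).differentiableAt)
    (fun s => (hd s).deriv) t 0
  simpa [Matrix.one_apply] using hc

/-- A Poincaré inequality with constant `Λ` bounds the total-variation distance to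
equilibrium at time `t` by `exp (- t / Λ) / (2 √(π x))`, through the chi-square distance
`φ` of the law at time `t` to `π`. -/
theorem tvDist_lt_of_poincare {Q : Matrix S S ℝ} {C : Finset S} {π : S → ℝ}
    (h : ReversibleOn Q C π) {Λ : ℝ} (hΛ : 0 < Λ)
    (hP : ∀ f : S → ℝ, ∑ x, ∑ y, π x * π y * (f x - f y) ^ 2
      ≤ Λ * ∑ x, ∑ y, π x * Q x y * (f x - f y) ^ 2)
    {x : S} (hx : x ∈ C) {t : ℝ} (ht : 0 ≤ t)
    (htx : Real.exp (-(2 / Λ) * t) / π x < 1 / 4) :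
    tvDist (fun y => NormedSpace.exp (t • Q) x y) π < 1 / 4 := by
  -- The signed measure `ν s` is the law at time `s` minus `π`, and `g s` is its density with
  -- respect to `π`; off `C` both vanish, where the quotient is the junk value `0 / 0 = 0`.
  set ν : ℝ → S → ℝ := fun s y => NormedSpace.exp (s • Q) x y - π y with hν
  set g : ℝ → S → ℝ := fun s y => ν s y / π y with hg
  have hπ0 : ∀ y, 0 ≤ π y := fun y => by
    by_cases hy : y ∈ C
    · exact (h.pos y hy).le
    · exact (h.zero y hy).ge
  have hνg : ∀ s y, ν s y = π y * g s y := by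
    intro s y
    by_cases hy : y ∈ C
    · have := (h.pos y hy).ne'
      simp only [hg]; field_simp
    · simp [hν, h.zero y hy, exp_apply_eq_zero h s hx hy]
  have hπQ : ∀ y, ∑ z, π z * Q z y = 0 := by
    intro y
    simp only [h.balance _ y, ← Finset.mul_sum, h.row_sum, mul_zero]
  have hνd : ∀ s y, HasDerivAt (fun u => ν u y) (∑ z, π z * g s z * Q z y) s := by
    intro s y
    have := (hasDerivAt_exp_smul_apply Q s x y).sub_const (π y)
    refine this.congr_deriv ?_
    have e : ∀ z, π z * g s z * Q z y
        = NormedSpace.exp (s • Q) x z * Q z y - π z * Q z y := by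
      intro z; rw [← hνg]; simp only [hν]; ring
    simp only [e, Finset.sum_sub_distrib, hπQ, sub_zero]
  have hsum : ∀ s, ∑ y, π y * g s y = 0 := by
    intro s
    simp only [← hνg, hν, Finset.sum_sub_distrib, sum_exp_apply h, h.sum_one, sub_self]
  set φ : ℝ → ℝ := fun s => ∑ y, π y * g s y ^ 2 with hφ
  have hφd : ∀ s, HasDerivAt φ (-∑ z, ∑ y, π z * Q z y * (g s z - g s y) ^ 2) s := by
    intro s
    rw [← two_mul_sum_balance h, Finset.mul_sum]
    refine HasDerivAt.fun_sum fun y _ => ?_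
    have h1 := (((hνd s y).div_const (π y)).pow 2).const_mul (π y)
    by_cases hy : y ∈ C
    · have hp := (h.pos y hy).ne'
      refine h1.congr_deriv ?_
      generalize (∑ z, π z * g s z * Q z y) = X
      simp only [hg]
      norm_num
      field_simp
    · have hz := h.zero y hy
      have : g s y = 0 := by simp [hg, hz]
      simp only [hz, zero_mul, this]
      simpa using hasDerivAt_const s (0 : ℝ)
  have hφle : ∀ s, -∑ z, ∑ y, π z * Q z y * (g s z - g s y) ^ 2 ≤ -(2 / Λ) * φ s := by
    intro s
    have h1 := hP (g s)
    rw [sum_sum_sq_sub h _ (hsum s)] at h1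
    rw [neg_mul, neg_le_neg_iff, div_mul_eq_mul_div, div_le_iff₀ hΛ, mul_comm _ Λ]
    exact h1
  have hanti : Antitone fun s => Real.exp (2 / Λ * s) * φ s := by
    have hd : ∀ s, HasDerivAt (fun s => Real.exp (2 / Λ * s) * φ s)
        (Real.exp (2 / Λ * s) * (2 / Λ * φ s
          + -∑ z, ∑ y, π z * Q z y * (g s z - g s y) ^ 2)) s := by
      intro s
      have h1 := (((hasDerivAt_id s).const_mul (2 / Λ)).exp).mul (hφd s)
      refine h1.congr_deriv ?_
      simp only [id]; ring
    refine antitone_of_deriv_nonpos (fun s => (hd s).differentiableAt) fun s => ?_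
    rw [(hd s).deriv]
    refine mul_nonpos_of_nonneg_of_nonpos (Real.exp_nonneg _) ?_
    have := hφle s
    linarith
  have hφ0 : φ 0 ≤ 1 / π x := by
    have hpx := h.pos x hx
    have e : ∀ y, π y * g 0 y ^ 2 = (if y = x then 1 / π x - 2 else 0) + π y := by
      intro y
      by_cases hy : y ∈ C
      · have hp := (h.pos y hy).ne'
        by_cases hxy : y = x
        · subst hxy
          simp [hg, hν]
          field_simp
          ring
        · have : (1 : Matrix S S ℝ) x y = 0 := Matrix.one_apply_ne (Ne.symm hxy)
          simp [hg, hν, hxy, this]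
          field_simp
      · have hxy : y ≠ x := fun e => hy (e ▸ hx)
        simp [h.zero y hy, hxy]
    simp only [hφ, e, Finset.sum_add_distrib, h.sum_one, Finset.sum_ite_eq', Finset.mem_univ,
      if_true]
    linarith
  have hφt : φ t < 1 / 4 := by
    have h1 := hanti ht
    simp only [mul_zero, Real.exp_zero, one_mul] at h1
    have h2 : φ t ≤ Real.exp (-(2 / Λ) * t) / π x := by
      have h3 := h1.trans hφ0
      have : φ t = Real.exp (-(2 / Λ) * t) * (Real.exp (2 / Λ * t) * φ t) := by
        rw [← mul_assoc, ← Real.exp_add]; simp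
      rw [this, div_eq_mul_one_div (Real.exp _) (π x)]
      exact mul_le_mul_of_nonneg_left h3 (Real.exp_nonneg _)
    exact h2.trans_lt htx
  -- Cauchy-Schwarz with the weights `π`.
  have hcs : (∑ y, |ν t y|) ^ 2 ≤ φ t := by
    have h1 := Finset.sum_mul_sq_le_sq_mul_sq Finset.univ (fun y => √(π y))
      (fun y => √(π y) * |g t y|)
    have e1 : ∀ y, √(π y) * (√(π y) * |g t y|) = |ν t y| := by
      intro y
      rw [← mul_assoc, Real.mul_self_sqrt (hπ0 y), hνg, abs_mul, abs_of_nonneg (hπ0 y)]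
    have e2 : ∀ y, (√(π y) * |g t y|) ^ 2 = π y * g t y ^ 2 := by
      intro y; rw [mul_pow, Real.sq_sqrt (hπ0 y), sq_abs]
    simp only [e1, e2, Real.sq_sqrt (hπ0 _), h.sum_one, one_mul] at h1
    exact h1
  have hlt : ∑ y, |ν t y| < 1 / 2 :=
    lt_of_pow_lt_pow_left₀ 2 (by norm_num) (hcs.trans_lt (hφt.trans_le (by norm_num)))
  unfold tvDist
  change 1 / 2 * ∑ y, |ν t y| < 1 / 4
  linarith

end Chain

/-! ### Glauber dynamics with frozen vertices -/

section Glauber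

variable {N : ℕ}

lemma gibbs_pos (β : ℝ) (J : Couplings N) (σ : Config N) : 0 < gibbs β J σ :=
  div_pos (Real.exp_pos _) (Finset.sum_pos (fun _ _ => Real.exp_pos _) Finset.univ_nonempty)

lemma mem_frozenSet {F : Finset (Fin N)} {η σ : Config N} :
    σ ∈ frozenSet F η ↔ ∀ v ∈ F, σ v = η v := by
  simp [frozenSet]

lemma self_mem_frozenSet (F : Finset (Fin N)) (η : Config N) : η ∈ frozenSet F η :=
  mem_frozenSet.2 fun _ _ => rfl

lemma gibbs_sum_pos (β : ℝ) (J : Couplings N) (F : Finset (Fin N)) (η : Config N) :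
    0 < ∑ τ ∈ frozenSet F η, gibbs β J τ :=
  Finset.sum_pos (fun _ _ => gibbs_pos _ _ _) ⟨η, self_mem_frozenSet F η⟩

lemma gibbsOn_of_mem (β : ℝ) (J : Couplings N) {C : Finset (Config N)} {σ : Config N}
    (h : σ ∈ C) : gibbsOn β J C σ = gibbs β J σ / ∑ τ ∈ C, gibbs β J τ := by
  simp [gibbsOn, h]

lemma gibbsOn_of_notMem (β : ℝ) (J : Couplings N) {C : Finset (Config N)} {σ : Config N}
    (h : σ ∉ C) : gibbsOn β J C σ = 0 := by
  simp [gibbsOn, h]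

lemma eq_update_of_forall_ne {σ τ : Config N} {v : Fin N} (h : ∀ w, w ≠ v → τ w = σ w) :
    τ = Function.update σ v (τ v) := by
  ext1 w
  by_cases hw : w = v
  · subst hw; simp
  · simp [hw, h w hw]

lemma resampleKernel_nonneg (β : ℝ) (J : Couplings N) (v : Fin N) (σ τ : Config N) :
    0 ≤ resampleKernel β J v σ τ := by
  simp only [resampleKernel, Matrix.of_apply]
  split_ifs
  · exact div_nonneg (gibbs_pos _ _ _).le (Finset.sum_nonneg fun _ _ => (gibbs_pos _ _ _).le)
  · exact le_rfl

lemma resampleKernel_sum (β : ℝ) (J : Couplings N) (v : Fin N) (σ : Config N) :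
    ∑ τ, resampleKernel β J v σ τ = 1 := by
  simp only [resampleKernel, Matrix.of_apply]
  rw [← Finset.sum_filter, ← Finset.sum_div]
  have : ∑ τ ∈ Finset.univ.filter (fun τ : Config N => ∀ w, w ≠ v → τ w = σ w), gibbs β J τ
      = ∑ s : ℤˣ, gibbs β J (Function.update σ v s) := by
    refine Finset.sum_bij' (fun τ _ => τ v) (fun s _ => Function.update σ v s) ?_ ?_ ?_ ?_ ?_
    · exact fun _ _ => Finset.mem_univ _
    · intro s _
      simp only [Finset.mem_filter, Finset.mem_univ, true_and]
      intro w hw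
      simp [hw]
    · intro τ hτ
      exact (eq_update_of_forall_ne (by simpa using hτ)).symm
    · simp
    · intro τ hτ
      rw [← eq_update_of_forall_ne (by simpa using hτ)]
  rw [this, div_self]
  exact (Finset.sum_pos (fun _ _ => gibbs_pos _ _ _) Finset.univ_nonempty).ne'

lemma gibbs_mul_resampleKernel_comm (β : ℝ) (J : Couplings N) (v : Fin N) (σ τ : Config N) :
    gibbs β J σ * resampleKernel β J v σ τ = gibbs β J τ * resampleKernel β J v τ σ := by
  simp only [resampleKernel, Matrix.of_apply]
  by_cases h : ∀ w, w ≠ v → τ w = σ w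
  · have h' : ∀ w, w ≠ v → σ w = τ w := fun w hw => (h w hw).symm
    rw [if_pos h, if_pos h']
    have : ∀ s, Function.update σ v s = Function.update τ v s := by
      intro s; ext1 w
      by_cases hw : w = v
      · subst hw; simp
      · simp [hw, h w hw]
    simp only [this]; ring
  · have h' : ¬ ∀ w, w ≠ v → σ w = τ w := fun h' => h fun w hw => (h' w hw).symm
    rw [if_neg h, if_neg h']; simp

lemma glauberGenerator_apply (β : ℝ) (J : Couplings N) (F : Finset (Fin N)) (σ τ : Config N) :
    glauberGenerator β J F σ τ
      = ∑ v, if v ∈ F then 0 else resampleKernel β J v σ τ - (1 : Matrix _ _ ℝ) σ τ := by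
  simp only [glauberGenerator, Matrix.sum_apply, Matrix.sub_apply]
  refine Finset.sum_congr rfl fun v _ => ?_
  split_ifs <;> simp

lemma resampleKernel_le_glauberGenerator (β : ℝ) (J : Couplings N) {F : Finset (Fin N)}
    {v : Fin N} (hv : v ∉ F) {σ τ : Config N} (h : σ ≠ τ) :
    resampleKernel β J v σ τ ≤ glauberGenerator β J F σ τ := by
  rw [glauberGenerator_apply]
  have := Finset.single_le_sum (f := fun v => if v ∈ F then 0 else
    resampleKernel β J v σ τ - (1 : Matrix _ _ ℝ) σ τ) (s := Finset.univ) ?_ (Finset.mem_univ v)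
  · simpa [hv, Matrix.one_apply_ne h] using this
  · intro u _
    split_ifs
    · exact le_rfl
    · rw [Matrix.one_apply_ne h, sub_zero]; exact resampleKernel_nonneg _ _ _ _ _

lemma mem_frozenSet_congr {F : Finset (Fin N)} {η σ τ : Config N} {v : Fin N} (hv : v ∉ F)
    (h : ∀ w, w ≠ v → τ w = σ w) : σ ∈ frozenSet F η ↔ τ ∈ frozenSet F η := by
  simp only [mem_frozenSet]
  refine forall₂_congr fun w hw => ?_
  rw [h w fun e => hv (e ▸ hw)]

/-- Glauber dynamics with frozen vertices is reversible with respect to the conditioned Gibbs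
measure. -/
lemma glauberGenerator_reversibleOn (β : ℝ) (J : Couplings N) (F : Finset (Fin N))
    (η : Config N) :
    ReversibleOn (glauberGenerator β J F) (frozenSet F η) (gibbsOn β J (frozenSet F η)) where
  row_sum σ := by
    simp only [glauberGenerator_apply]
    rw [Finset.sum_comm]
    refine Finset.sum_eq_zero fun v _ => ?_
    split_ifs
    · simp
    · rw [Finset.sum_sub_distrib, resampleKernel_sum]
      simp [Matrix.one_apply]
  off_diag_nonneg σ τ h := by
    rw [glauberGenerator_apply]
    refine Finset.sum_nonneg fun v _ => ?_
    split_ifs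
    · exact le_rfl
    · rw [Matrix.one_apply_ne h, sub_zero]; exact resampleKernel_nonneg _ _ _ _ _
  closed σ τ h := by
    by_contra hC
    have hne : σ ≠ τ := fun e => hC (by rw [e])
    refine h ?_
    rw [glauberGenerator_apply]
    refine Finset.sum_eq_zero fun v _ => ?_
    split_ifs with hv
    · rfl
    · rw [Matrix.one_apply_ne hne, sub_zero]
      simp only [resampleKernel, Matrix.of_apply]
      exact if_neg fun h' => hC (mem_frozenSet_congr hv h')
  balance σ τ := by
    simp only [glauberGenerator_apply, Finset.mul_sum]
    refine Finset.sum_congr rfl fun v _ => ?_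
    split_ifs with hv
    · simp
    · by_cases hst : σ = τ
      · rw [hst]
      rw [Matrix.one_apply_ne hst, Matrix.one_apply_ne (Ne.symm hst), sub_zero, sub_zero]
      by_cases h : ∀ w, w ≠ v → τ w = σ w
      · have hm := mem_frozenSet_congr (η := η) hv h
        by_cases hs : σ ∈ frozenSet F η
        · rw [gibbsOn_of_mem _ _ hs, gibbsOn_of_mem _ _ (hm.1 hs), div_mul_eq_mul_div,
            div_mul_eq_mul_div, gibbs_mul_resampleKernel_comm]
        · rw [gibbsOn_of_notMem _ _ hs, gibbsOn_of_notMem _ _ fun h => hs (hm.2 h)]; simp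
      · have h' : ¬ ∀ w, w ≠ v → σ w = τ w := fun h' => h fun w hw => (h' w hw).symm
        simp only [resampleKernel, Matrix.of_apply]
        rw [if_neg h, if_neg h']; simp
  pos σ h := by
    rw [gibbsOn_of_mem _ _ h]
    exact div_pos (gibbs_pos _ _ _) (gibbs_sum_pos _ _ _ _)
  zero σ h := gibbsOn_of_notMem _ _ h
  sum_one := by
    simp only [gibbsOn]
    rw [← Finset.sum_filter, ← Finset.sum_div, Finset.filter_mem_eq_inter, Finset.univ_inter]
    exact div_self (gibbs_sum_pos _ _ _ _).ne'

lemma sum_gibbs_update (β : ℝ) (J : Couplings N) {σ τ : Config N} {v : Fin N} (hne : σ ≠ τ)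
    (h : ∀ w, w ≠ v → τ w = σ w) :
    ∑ s : ℤˣ, gibbs β J (Function.update σ v s) = gibbs β J σ + gibbs β J τ := by
  have hv : σ v ≠ τ v := by
    intro e
    refine hne (funext fun w => ?_)
    by_cases hw : w = v
    · rw [hw, e]
    · exact (h w hw).symm
  have hu : (Finset.univ : Finset ℤˣ) = {σ v, τ v} := by
    revert hv; generalize σ v = p; generalize τ v = q; revert p q; decide
  rw [hu, Finset.sum_pair hv, Function.update_eq_self, ← eq_update_of_forall_ne h]

/-- The conductance of a single spin flip is at least half the smaller of the two weights. -/
lemma half_min_le_conductance (β : ℝ) (J : Couplings N) {F : Finset (Fin N)} {η : Config N}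
    {v : Fin N} (hv : v ∉ F) {σ τ : Config N} (hne : σ ≠ τ) (h : ∀ w, w ≠ v → τ w = σ w)
    (hσ : σ ∈ frozenSet F η) (hτ : τ ∈ frozenSet F η) :
    min (gibbsOn β J (frozenSet F η) σ) (gibbsOn β J (frozenSet F η) τ) / 2
      ≤ gibbsOn β J (frozenSet F η) σ * glauberGenerator β J F σ τ := by
  have hZ := gibbs_sum_pos β J F η
  have hk : resampleKernel β J v σ τ = gibbs β J τ / (gibbs β J σ + gibbs β J τ) := by
    simp only [resampleKernel, Matrix.of_apply]
    rw [if_pos h, sum_gibbs_update β J hne h]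
  have h1 := resampleKernel_le_glauberGenerator β J hv hne
  refine le_trans ?_ (mul_le_mul_of_nonneg_left h1
    ((glauberGenerator_reversibleOn β J F η).pos σ hσ).le)
  rw [gibbsOn_of_mem _ _ hσ, gibbsOn_of_mem _ _ hτ, hk, min_div_div_right hZ.le,
    div_mul_eq_mul_div, div_right_comm]
  refine div_le_div_of_nonneg_right ?_ hZ.le
  have ha := gibbs_pos β J σ
  have hb := gibbs_pos β J τ
  generalize gibbs β J σ = p at *
  generalize gibbs β J τ = q at *
  rw [mul_div_assoc', le_div_iff₀ (by positivity)]
  rcases le_total p q with hpq | hpq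
  · rw [min_eq_left hpq]; nlinarith
  · rw [min_eq_right hpq]; nlinarith

end Glauber

/-! ### Canonical paths along a matching -/

section Paths

variable {N : ℕ}

/-- The configuration that equals `τ` on the vertices of rank below `k` and `σ` elsewhere. -/
def interpolate (r : Fin N → ℕ) (σ τ : Config N) (k : ℕ) : Config N :=
  fun v => if r v < k then τ v else σ v

/-- An ordering of the vertices in which the two endpoints of each bond of the matching `M` are
neighbours: the larger endpoint of a bond comes directly after the smaller one. -/
noncomputable def matchingRank (M : Finset (Bond N)) (v : Fin N) : ℕ :=
  if h : ∃ b ∈ M, b.1.2 = v then 2 * (h.choose.1.1 : ℕ) + 1 else 2 * v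

/-- The contribution of the bond `b` to the Hamiltonian. -/
def bondEnergy (J : Couplings N) (b : Bond N) (σ : Config N) : ℝ :=
  J b * spin (σ b.1.1) * spin (σ b.1.2)

section Rank

variable {M : Finset (Bond N)}

lemma matchingRank_snd (hM : ∀ b ∈ M, ∀ c ∈ M, b ≠ c → VertexDisjoint b c)
    {b : Bond N} (hb : b ∈ M) : matchingRank M b.1.2 = 2 * (b.1.1 : ℕ) + 1 := by
  have h : ∃ c ∈ M, c.1.2 = b.1.2 := ⟨b, hb, rfl⟩
  have hc := h.choose_spec
  have : h.choose = b := by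
    by_contra hne
    exact (hM _ hc.1 _ hb hne).2.2.2 hc.2
  rw [matchingRank, dif_pos h, this]

lemma matchingRank_fst (hM : ∀ b ∈ M, ∀ c ∈ M, b ≠ c → VertexDisjoint b c)
    {b : Bond N} (hb : b ∈ M) : matchingRank M b.1.1 = 2 * (b.1.1 : ℕ) := by
  rw [matchingRank, dif_neg]
  rintro ⟨c, hc, hcb⟩
  by_cases hne : c = b
  · subst hne; exact absurd hcb c.2.ne'
  · exact (hM _ hc _ hb hne).2.2.1 hcb

lemma matchingRank_injective (hM : ∀ b ∈ M, ∀ c ∈ M, b ≠ c → VertexDisjoint b c) :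
    Function.Injective (matchingRank M) := by
  intro v w h
  by_cases hv : ∃ b ∈ M, b.1.2 = v <;> by_cases hw : ∃ b ∈ M, b.1.2 = w
  · obtain ⟨b, hb, rfl⟩ := hv
    obtain ⟨c, hc, rfl⟩ := hw
    rw [matchingRank_snd hM hb, matchingRank_snd hM hc] at h
    have : b = c := by
      by_contra hne
      exact (hM _ hb _ hc hne).1 (Fin.ext (by omega))
    rw [this]
  · obtain ⟨b, hb, rfl⟩ := hv
    rw [matchingRank_snd hM hb, matchingRank, dif_neg hw] at h
    omega
  · obtain ⟨b, hb, rfl⟩ := hw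
    rw [matchingRank_snd hM hb, matchingRank, dif_neg hv] at h
    omega
  · rw [matchingRank, matchingRank, dif_neg hw, dif_neg hv] at h
    exact Fin.ext (by omega)

end Rank

lemma matchingRank_lt (M : Finset (Bond N)) (v : Fin N) : matchingRank M v < 2 * N := by
  unfold matchingRank
  split_ifs with h
  · have := h.choose.1.1.2; omega
  · have := v.2; omega

lemma interpolate_zero (r : Fin N → ℕ) (σ τ : Config N) : interpolate r σ τ 0 = σ := by
  ext1 v; simp [interpolate]

lemma interpolate_of_lt {r : Fin N → ℕ} {k : ℕ} (h : ∀ v, r v < k) (σ τ : Config N) :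
    interpolate r σ τ k = τ := by
  ext1 v; simp [interpolate, h v]

lemma interpolate_mem {F : Finset (Fin N)} {η σ τ : Config N} (hσ : σ ∈ frozenSet F η)
    (hτ : τ ∈ frozenSet F η) (r : Fin N → ℕ) (k : ℕ) :
    interpolate r σ τ k ∈ frozenSet F η := by
  rw [mem_frozenSet] at *
  intro v hv
  unfold interpolate
  split_ifs
  · exact hτ v hv
  · exact hσ v hv

lemma abs_bondEnergy (J : Couplings N) (b : Bond N) (σ : Config N) :
    |bondEnergy J b σ| = |J b| := by
  have h : ∀ s : ℤˣ, |spin s| = 1 := by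
    intro s
    rcases Int.units_eq_one_or s with rfl | rfl <;> simp [spin]
  simp [bondEnergy, abs_mul, h]

lemma bondEnergy_congr {J : Couplings N} {b : Bond N} {σ τ : Config N}
    (h1 : σ b.1.1 = τ b.1.1) (h2 : σ b.1.2 = τ b.1.2) : bondEnergy J b σ = bondEnergy J b τ := by
  rw [bondEnergy, bondEnergy, h1, h2]

lemma hamiltonian_eq_sum (J : Couplings N) (σ : Config N) :
    hamiltonian J σ = ∑ b, bondEnergy J b σ := rfl

/-- Energy barrier along the interpolation path. At each time at most one bond of the
matching `M` is cut; comparing with the reversed path just before or just after that bond is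
cut shows that it costs at most `2 * m`. All other bonds are bounded by brute force. -/
lemma exists_energy_barrier {F : Finset (Fin N)} {M : Finset (Bond N)}
    (hM : ∀ b ∈ M, ∀ c ∈ M, b ≠ c → VertexDisjoint b c) (J : Couplings N) {m : ℝ} (hm0 : 0 ≤ m)
    (hm : ∀ b ∈ M, b.1.1 ∉ F → b.1.2 ∉ F → |J b| ≤ m) {σ τ : Config N}
    (hστ : ∀ v ∈ F, σ v = τ v) (k : ℕ) :
    ∃ j, hamiltonian J σ + hamiltonian J τ
        - hamiltonian J (interpolate (matchingRank M) σ τ k)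
        - hamiltonian J (interpolate (matchingRank M) τ σ j)
      ≤ 2 * m + 4 * ∑ b ∈ Mᶜ, |J b| := by
  set z := interpolate (matchingRank M) σ τ k with hz
  set z' := fun j => interpolate (matchingRank M) τ σ j with hz'
  set Δ : ℕ → Bond N → ℝ := fun j b =>
    bondEnergy J b σ + bondEnergy J b τ - bondEnergy J b z - bondEnergy J b (z' j) with hΔ
  have hlt : ∀ b ∈ M, ∀ j, 2 * (b.1.1 : ℕ) + 1 < k → 2 * (b.1.1 : ℕ) + 1 < j → Δ j b = 0 := by
    intro b hb j h1 h2
    have e1 : bondEnergy J b z = bondEnergy J b τ := by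
      apply bondEnergy_congr <;> simp only [hz, interpolate]
      · rw [matchingRank_fst hM hb, if_pos (by omega)]
      · rw [matchingRank_snd hM hb, if_pos (by omega)]
    have e2 : bondEnergy J b (z' j) = bondEnergy J b σ := by
      apply bondEnergy_congr <;> simp only [hz', interpolate]
      · rw [matchingRank_fst hM hb, if_pos (by omega)]
      · rw [matchingRank_snd hM hb, if_pos (by omega)]
    simp only [hΔ, e1, e2]; ring
  have hge : ∀ b ∈ M, ∀ j, k ≤ 2 * (b.1.1 : ℕ) → j ≤ 2 * (b.1.1 : ℕ) → Δ j b = 0 := by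
    intro b hb j h1 h2
    have e1 : bondEnergy J b z = bondEnergy J b σ := by
      apply bondEnergy_congr <;> simp only [hz, interpolate]
      · rw [matchingRank_fst hM hb, if_neg (by omega)]
      · rw [matchingRank_snd hM hb, if_neg (by omega)]
    have e2 : bondEnergy J b (z' j) = bondEnergy J b τ := by
      apply bondEnergy_congr <;> simp only [hz', interpolate]
      · rw [matchingRank_fst hM hb, if_neg (by omega)]
      · rw [matchingRank_snd hM hb, if_neg (by omega)]
    simp only [hΔ, e1, e2]; ring
  -- The cut at time `k` separates the endpoints of `b ∈ M` exactly when `k = 2 * b.1.1 + 1`.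
  have hmain : ∃ j, ∑ b ∈ M, Δ j b ≤ 2 * m := by
    by_cases hcut : ∃ b ∈ M, k = 2 * (b.1.1 : ℕ) + 1
    · obtain ⟨b, hb, hk⟩ := hcut
      have hother : ∀ j, (j = k - 1 ∨ j = k + 1) → ∀ c ∈ M, c ≠ b → Δ j c = 0 := by
        intro j hj c hc hcb
        have : (c.1.1 : ℕ) ≠ b.1.1 := fun e => (hM _ hc _ hb hcb).1 (Fin.ext e)
        rcases lt_or_gt_of_ne this with h | h
        · exact hlt c hc j (by omega) (by omega)
        · exact hge c hc j (by omega) (by omega)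
      have eafter : bondEnergy J b (z' (k + 1)) = bondEnergy J b σ := by
        apply bondEnergy_congr <;> simp only [hz', interpolate]
        · rw [matchingRank_fst hM hb, if_pos (by omega)]
        · rw [matchingRank_snd hM hb, if_pos (by omega)]
      have ebefore : bondEnergy J b (z' (k - 1)) = bondEnergy J b τ := by
        apply bondEnergy_congr <;> simp only [hz', interpolate]
        · rw [matchingRank_fst hM hb, if_neg (by omega)]
        · rw [matchingRank_snd hM hb, if_neg (by omega)]
      have z1 : z b.1.1 = τ b.1.1 := by
        simp only [hz, interpolate]
        rw [matchingRank_fst hM hb, if_pos (by omega)]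
      have z2 : z b.1.2 = σ b.1.2 := by
        simp only [hz, interpolate]
        rw [matchingRank_snd hM hb, if_neg (by omega)]
      have hmin : min (bondEnergy J b σ) (bondEnergy J b τ) - bondEnergy J b z ≤ 2 * m := by
        by_cases h1 : b.1.1 ∈ F
        · have : bondEnergy J b z = bondEnergy J b σ :=
            bondEnergy_congr (by rw [z1, hστ _ h1]) z2
          rw [this]
          linarith [min_le_left (bondEnergy J b σ) (bondEnergy J b τ)]
        by_cases h2 : b.1.2 ∈ F
        · have : bondEnergy J b z = bondEnergy J b τ :=
            bondEnergy_congr z1 (by rw [z2, hστ _ h2])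
          rw [this]
          linarith [min_le_right (bondEnergy J b σ) (bondEnergy J b τ)]
        have hJ := hm b hb h1 h2
        have a1 := le_abs_self (bondEnergy J b σ)
        have a2 := neg_abs_le (bondEnergy J b z)
        rw [abs_bondEnergy] at a1 a2
        linarith [min_le_left (bondEnergy J b σ) (bondEnergy J b τ)]
      -- Just before `k` the reversed path has the values of `τ` on `b`, just after `k` those of `σ`.
      rcases le_total (bondEnergy J b σ) (bondEnergy J b τ) with h | h
      · refine ⟨k - 1, ?_⟩
        rw [Finset.sum_eq_single_of_mem b hb (hother _ (Or.inl rfl))]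
        rw [min_eq_left h] at hmin
        simp only [hΔ, ebefore]; linarith
      · refine ⟨k + 1, ?_⟩
        rw [Finset.sum_eq_single_of_mem b hb (hother _ (Or.inr rfl))]
        rw [min_eq_right h] at hmin
        simp only [hΔ, eafter]; linarith
    · refine ⟨k, ?_⟩
      rw [Finset.sum_eq_zero]
      · linarith
      · intro b hb
        have : k ≠ 2 * (b.1.1 : ℕ) + 1 := fun e => hcut ⟨b, hb, e⟩
        by_cases h : k ≤ 2 * (b.1.1 : ℕ)
        · exact hge b hb k h h
        · exact hlt b hb k (by omega) (by omega)
  obtain ⟨j, hj⟩ := hmain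
  refine ⟨j, ?_⟩
  have hrest : ∑ b ∈ Mᶜ, Δ j b ≤ 4 * ∑ b ∈ Mᶜ, |J b| := by
    rw [Finset.mul_sum]
    refine Finset.sum_le_sum fun b _ => ?_
    have a1 := le_abs_self (bondEnergy J b σ)
    have a2 := le_abs_self (bondEnergy J b τ)
    have a3 := neg_abs_le (bondEnergy J b z)
    have a4 := neg_abs_le (bondEnergy J b (z' j))
    rw [abs_bondEnergy] at a1 a2 a3 a4
    simp only [hΔ]; linarith
  have htot : hamiltonian J σ + hamiltonian J τ - hamiltonian J z - hamiltonian J (z' j)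
      = ∑ b ∈ M, Δ j b + ∑ b ∈ Mᶜ, Δ j b := by
    rw [Finset.sum_add_sum_compl]
    simp only [hamiltonian_eq_sum, hΔ, Finset.sum_add_distrib, Finset.sum_sub_distrib]
  change hamiltonian J σ + hamiltonian J τ - hamiltonian J z - hamiltonian J (z' j) ≤ _
  rw [htot]; linarith

/-- Congestion bound in exponential form: the partition function in the denominator of
`π(σ) π(τ) / π(z)` is bounded below by the weight of the comparison configuration. -/
lemma gibbsOn_mul_gibbsOn_le {F : Finset (Fin N)} {η σ τ z z' : Config N} {β B : ℝ}
    (hβ : 0 ≤ β) (J : Couplings N) (hσ : σ ∈ frozenSet F η) (hτ : τ ∈ frozenSet F η)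
    (hz : z ∈ frozenSet F η) (hz' : z' ∈ frozenSet F η)
    (hB : hamiltonian J σ + hamiltonian J τ - hamiltonian J z - hamiltonian J z' ≤ B) :
    gibbsOn β J (frozenSet F η) σ * gibbsOn β J (frozenSet F η) τ
      ≤ Real.exp (β * B) * gibbsOn β J (frozenSet F η) z := by
  have hZ := gibbs_sum_pos β J F η
  rw [gibbsOn_of_mem _ _ hσ, gibbsOn_of_mem _ _ hτ, gibbsOn_of_mem _ _ hz]
  have h1 : gibbs β J σ * gibbs β J τ ≤ Real.exp (β * B) * (gibbs β J z * gibbs β J z') := by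
    unfold gibbs
    have hW : 0 < ∑ τ : Config N, Real.exp (β * hamiltonian J τ) :=
      Finset.sum_pos (fun _ _ => Real.exp_pos _) Finset.univ_nonempty
    rw [div_mul_div_comm, div_mul_div_comm, mul_div_assoc', ← Real.exp_add, ← Real.exp_add,
      ← Real.exp_add]
    refine div_le_div_of_nonneg_right (Real.exp_le_exp.2 ?_) (by positivity)
    nlinarith [mul_le_mul_of_nonneg_left hB hβ]
  have h2 : gibbs β J z' ≤ ∑ τ ∈ frozenSet F η, gibbs β J τ :=
    Finset.single_le_sum (f := gibbs β J) (fun _ _ => (gibbs_pos _ _ _).le) hz'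
  rw [div_mul_div_comm, mul_div_assoc', div_le_div_iff₀ (by positivity) hZ]
  have h3 : Real.exp (β * B) * (gibbs β J z * gibbs β J z')
      ≤ Real.exp (β * B) * (gibbs β J z * ∑ τ ∈ frozenSet F η, gibbs β J τ) := by
    have := (gibbs_pos β J z).le
    gcongr
  nlinarith [mul_le_mul_of_nonneg_right (h1.trans h3) hZ.le]

/-- Poincaré inequality for the restricted dynamics by the canonical-path method. The
path counting is crude: a factor exponential in `N` is harmless. -/
theorem poincare_restricted {F : Finset (Fin N)} {M : Finset (Bond N)}
    (hM : ∀ b ∈ M, ∀ c ∈ M, b ≠ c → VertexDisjoint b c) (J : Couplings N) {m β : ℝ}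
    (hβ : 0 ≤ β) (hm0 : 0 ≤ m)
    (hm : ∀ b ∈ M, b.1.1 ∉ F → b.1.2 ∉ F → |J b| ≤ m) (η : Config N) (f : Config N → ℝ) :
    ∑ x, ∑ y, gibbsOn β J (frozenSet F η) x * gibbsOn β J (frozenSet F η) y * (f x - f y) ^ 2
      ≤ (8 * (N : ℝ) ^ 2 * 4 ^ N * Real.exp (β * (2 * m + 4 * ∑ b ∈ Mᶜ, |J b|))) *
        ∑ x, ∑ y, gibbsOn β J (frozenSet F η) x * glauberGenerator β J F x y
          * (f x - f y) ^ 2 := by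
  set C := frozenSet F η with hC
  set π := gibbsOn β J C with hπ
  set Q := glauberGenerator β J F with hQ
  set A := Real.exp (β * (2 * m + 4 * ∑ b ∈ Mᶜ, |J b|)) with hA
  have hrev : ReversibleOn Q C π := glauberGenerator_reversibleOn β J F η
  have hπ0 : ∀ y, 0 ≤ π y := fun y => by
    by_cases hy : y ∈ C
    · exact (hrev.pos y hy).le
    · exact (hrev.zero y hy).ge
  have hterm : ∀ x y, 0 ≤ π x * Q x y * (f x - f y) ^ 2 := by
    intro x y
    by_cases hxy : x = y
    · simp [hxy]
    · exact mul_nonneg (mul_nonneg (hπ0 x) (hrev.off_diag_nonneg x y hxy)) (sq_nonneg _)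
  set E := ∑ x, ∑ y, π x * Q x y * (f x - f y) ^ 2 with hE
  have hE0 : 0 ≤ E := Finset.sum_nonneg fun x _ => Finset.sum_nonneg fun y _ => hterm x y
  have hsingle : ∀ x y, π x * Q x y * (f x - f y) ^ 2 ≤ E := by
    intro x y
    refine le_trans ?_ (Finset.single_le_sum (f := fun x => ∑ y, π x * Q x y * (f x - f y) ^ 2)
      (fun x _ => Finset.sum_nonneg fun y _ => hterm x y) (Finset.mem_univ x))
    exact Finset.single_le_sum (f := fun y => π x * Q x y * (f x - f y) ^ 2)
      (fun y _ => hterm x y) (Finset.mem_univ y)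
  have hpair : ∀ σ τ, π σ * π τ * (f σ - f τ) ^ 2 ≤ 8 * (N : ℝ) ^ 2 * A * E := by
    intro σ τ
    by_cases hσ : σ ∈ C
    swap
    · rw [hrev.zero σ hσ]; simp only [zero_mul]; positivity
    by_cases hτ : τ ∈ C
    swap
    · rw [hrev.zero τ hτ]; simp only [mul_zero, zero_mul]; positivity
    set z := interpolate (matchingRank M) σ τ with hz
    have hστ : ∀ v ∈ F, σ v = τ v := fun v hv => by
      rw [mem_frozenSet.1 hσ v hv, mem_frozenSet.1 hτ v hv]
    have hcong : ∀ k, π σ * π τ ≤ A * π (z k) := by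
      intro k
      obtain ⟨j, hj⟩ := exists_energy_barrier hM J hm0 hm hστ k
      exact gibbsOn_mul_gibbsOn_le hβ J hσ hτ (interpolate_mem hσ hτ _ k)
        (interpolate_mem hτ hσ _ j) hj
    -- A step of the path either does nothing or flips the unique vertex of rank `k`.
    have hstep : ∀ k, π σ * π τ * (f (z k) - f (z (k + 1))) ^ 2 ≤ 2 * A * E := by
      intro k
      by_cases hne : z k = z (k + 1)
      · rw [hne]; rw [sub_self, zero_pow two_ne_zero, mul_zero]; positivity
      obtain ⟨v, hv⟩ := Function.ne_iff.1 hne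
      have hvk : matchingRank M v = k := by
        by_contra h
        apply hv
        simp only [hz, interpolate]
        by_cases h1 : matchingRank M v < k
        · rw [if_pos h1, if_pos (by omega)]
        · rw [if_neg h1, if_neg (by omega)]
      have hvF : v ∉ F := fun hF => hv (by
        simp only [hz, interpolate, hστ v hF, ite_self])
      have hagree : ∀ w, w ≠ v → z (k + 1) w = z k w := by
        intro w hw
        have h : matchingRank M w ≠ k := fun e =>
          hw (matchingRank_injective hM (e.trans hvk.symm))
        simp only [hz, interpolate]
        by_cases h1 : matchingRank M w < k
        · rw [if_pos h1, if_pos (by omega)]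
        · rw [if_neg h1, if_neg (by omega)]
      have h1 := half_min_le_conductance β J hvF hne hagree (interpolate_mem hσ hτ _ k)
        (interpolate_mem hσ hτ _ (k + 1))
      have h2 : π σ * π τ ≤ A * min (π (z k)) (π (z (k + 1))) := by
        rcases le_total (π (z k)) (π (z (k + 1))) with h | h
        · rw [min_eq_left h]; exact hcong k
        · rw [min_eq_right h]; exact hcong (k + 1)
      have h3 : π σ * π τ ≤ 2 * A * (π (z k) * Q (z k) (z (k + 1))) := by
        refine h2.trans ?_
        have hA0 : 0 ≤ A := (Real.exp_pos _).le
        have := mul_le_mul_of_nonneg_left h1 hA0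
        change A * (min (π (z k)) (π (z (k + 1))) / 2) ≤ A * (π (z k) * Q (z k) (z (k + 1)))
          at this
        linarith
      calc π σ * π τ * (f (z k) - f (z (k + 1))) ^ 2
          ≤ 2 * A * (π (z k) * Q (z k) (z (k + 1))) * (f (z k) - f (z (k + 1))) ^ 2 :=
            mul_le_mul_of_nonneg_right h3 (sq_nonneg _)
        _ = 2 * A * (π (z k) * Q (z k) (z (k + 1)) * (f (z k) - f (z (k + 1))) ^ 2) := by ring
        _ ≤ 2 * A * E := mul_le_mul_of_nonneg_left (hsingle _ _) (by positivity)
    have htel : f σ - f τ = ∑ k ∈ Finset.range (2 * N), (f (z k) - f (z (k + 1))) := by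
      rw [Finset.sum_range_sub' (fun k => f (z k)), hz, interpolate_zero,
        interpolate_of_lt (matchingRank_lt M)]
    have hsq : (f σ - f τ) ^ 2
        ≤ (2 * N : ℕ) * ∑ k ∈ Finset.range (2 * N), (f (z k) - f (z (k + 1))) ^ 2 := by
      rw [htel]
      simpa using sq_sum_le_card_mul_sum_sq (s := Finset.range (2 * N))
        (f := fun k => f (z k) - f (z (k + 1)))
    calc π σ * π τ * (f σ - f τ) ^ 2
        ≤ π σ * π τ * ((2 * N : ℕ) * ∑ k ∈ Finset.range (2 * N),
            (f (z k) - f (z (k + 1))) ^ 2) :=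
          mul_le_mul_of_nonneg_left hsq (mul_nonneg (hπ0 _) (hπ0 _))
      _ = (2 * N : ℕ) * ∑ k ∈ Finset.range (2 * N),
            π σ * π τ * (f (z k) - f (z (k + 1))) ^ 2 := by
          rw [← Finset.mul_sum]; ring
      _ ≤ (2 * N : ℕ) * ∑ k ∈ Finset.range (2 * N), 2 * A * E := by
          exact mul_le_mul_of_nonneg_left (Finset.sum_le_sum fun k _ => hstep k) (Nat.cast_nonneg _)
      _ = 8 * (N : ℝ) ^ 2 * A * E := by
          rw [Finset.sum_const, Finset.card_range, nsmul_eq_mul]; push_cast; ring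
  have hcard : (Fintype.card (Config N) : ℝ) = 2 ^ N := by
    simp [Fintype.card_units_int]
  calc ∑ x, ∑ y, π x * π y * (f x - f y) ^ 2
      ≤ ∑ _x : Config N, ∑ _y : Config N, 8 * (N : ℝ) ^ 2 * A * E :=
        Finset.sum_le_sum fun x _ => Finset.sum_le_sum fun y _ => hpair x y
    _ = 8 * (N : ℝ) ^ 2 * 4 ^ N * A * E := by
        simp only [Finset.sum_const, Finset.card_univ, nsmul_eq_mul, hcard]
        have : (4 : ℝ) ^ N = 2 ^ N * 2 ^ N := by rw [← mul_pow]; norm_num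
        rw [this]; ring

end Paths

/-! ### The mixing-time bound for typical disorder -/

section Typical

variable {N : ℕ}

lemma abs_hamiltonian_le (J : Couplings N) (σ : Config N) : |hamiltonian J σ| ≤ ∑ b, |J b| := by
  rw [hamiltonian_eq_sum]
  refine (Finset.abs_sum_le_sum_abs _ _).trans_eq ?_
  exact Finset.sum_congr rfl fun b _ => abs_bondEnergy J b σ

lemma exp_le_gibbsOn {β : ℝ} (hβ : 0 ≤ β) (J : Couplings N) {F : Finset (Fin N)}
    {η σ : Config N} (hσ : σ ∈ frozenSet F η) :
    Real.exp (-(N + 2 * β * ∑ b, |J b|)) ≤ gibbsOn β J (frozenSet F η) σ := by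
  have hZ := gibbs_sum_pos β J F η
  have hZ1 : ∑ τ ∈ frozenSet F η, gibbs β J τ ≤ 1 := by
    refine (Finset.sum_le_univ_sum_of_nonneg fun τ => (gibbs_pos β J τ).le).trans_eq ?_
    simp only [gibbs]
    rw [← Finset.sum_div]
    exact div_self (Finset.sum_pos (fun _ _ => Real.exp_pos _) Finset.univ_nonempty).ne'
  rw [gibbsOn_of_mem _ _ hσ, le_div_iff₀ hZ]
  refine (mul_le_of_le_one_right (Real.exp_nonneg _) hZ1).trans ?_
  have hH := fun τ => abs_le.1 (abs_hamiltonian_le J τ)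
  have hW : ∑ τ : Config N, Real.exp (β * hamiltonian J τ)
      ≤ Real.exp N * Real.exp (β * ∑ b, |J b|) := by
    calc ∑ τ : Config N, Real.exp (β * hamiltonian J τ)
        ≤ ∑ _τ : Config N, Real.exp (β * ∑ b, |J b|) :=
          Finset.sum_le_sum fun τ _ =>
            Real.exp_le_exp.2 (mul_le_mul_of_nonneg_left (hH τ).2 hβ)
      _ = 2 ^ N * Real.exp (β * ∑ b, |J b|) := by
          simp [Fintype.card_units_int]
      _ ≤ Real.exp N * Real.exp (β * ∑ b, |J b|) := by
          gcongr
          calc (2 : ℝ) ^ N ≤ Real.exp 1 ^ N := by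
                gcongr; linarith [Real.add_one_le_exp 1]
            _ = Real.exp N := by rw [← Real.exp_nat_mul, mul_one]
  rw [gibbs, le_div_iff₀ (Finset.sum_pos (fun _ _ => Real.exp_pos _) Finset.univ_nonempty)]
  refine (mul_le_mul_of_nonneg_left hW (Real.exp_nonneg _)).trans ?_
  rw [← Real.exp_add, ← Real.exp_add]
  refine Real.exp_le_exp.2 ?_
  nlinarith [mul_le_mul_of_nonneg_left (hH σ).1 hβ]

/-- The Poincaré inequality and the lower bound on the Gibbs weights give a mixing time of
order `exp (2 β m)`, up to the exponential of the slack `X`. -/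
theorem restrictedMixingTime_le {F : Finset (Fin N)} {M : Finset (Bond N)} (hN : 1 ≤ N)
    (hM : ∀ b ∈ M, ∀ c ∈ M, b ≠ c → VertexDisjoint b c) (J : Couplings N) {m β X : ℝ}
    (hβ : 0 ≤ β) (hm0 : 0 ≤ m)
    (hm : ∀ b ∈ M, b.1.1 ∉ F → b.1.2 ∉ F → |J b| ≤ m) (η : Config N)
    (hX : 8 * (N : ℝ) ^ 2 * 4 ^ N * (2 + N + 2 * β * ∑ b, |J b|)
      ≤ Real.exp (X - 4 * β * ∑ b ∈ Mᶜ, |J b|)) :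
    restrictedMixingTime β J F η ≤ ENNReal.ofReal (Real.exp (2 * β * m + X)) := by
  refine sInf_le ⟨Real.exp (2 * β * m + X), Real.exp_pos _, rfl, fun x hx => ?_⟩
  have hrev := glauberGenerator_reversibleOn β J F η
  set Λ := 8 * (N : ℝ) ^ 2 * 4 ^ N * Real.exp (β * (2 * m + 4 * ∑ b ∈ Mᶜ, |J b|)) with hΛ
  have hN0 : (0 : ℝ) < N := by exact_mod_cast hN
  have hΛ0 : 0 < Λ := by positivity
  refine tvDist_lt_of_poincare hrev hΛ0
    (poincare_restricted hM J hβ hm0 hm η) hx (Real.exp_nonneg _) ?_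
  set s := ∑ b, |J b| with hs
  have hs0 : 0 ≤ s := Finset.sum_nonneg fun _ _ => abs_nonneg _
  have hT : 2 + N + 2 * β * s ≤ Real.exp (2 * β * m + X) / Λ := by
    rw [le_div_iff₀ hΛ0]
    calc (2 + N + 2 * β * s) * Λ
        = (8 * (N : ℝ) ^ 2 * 4 ^ N * (2 + N + 2 * β * s))
            * Real.exp (β * (2 * m + 4 * ∑ b ∈ Mᶜ, |J b|)) := by rw [hΛ]; ring
      _ ≤ Real.exp (X - 4 * β * ∑ b ∈ Mᶜ, |J b|)
            * Real.exp (β * (2 * m + 4 * ∑ b ∈ Mᶜ, |J b|)) := by gcongr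
      _ = Real.exp (2 * β * m + X) := by rw [← Real.exp_add]; congr 1; ring
  have hpos := hrev.pos x hx
  rw [div_lt_iff₀ hpos]
  have h4 : Real.exp (-2) < 1 / 4 := by
    have h1 : (2 : ℝ) ^ 2 < Real.exp 1 ^ 2 := by
      gcongr
      linarith [Real.exp_one_gt_d9]
    rw [← Real.exp_nat_mul] at h1
    rw [Real.exp_neg, ← one_div]
    refine one_div_lt_one_div_of_lt (by norm_num) ?_
    norm_num at h1 ⊢
    exact h1
  have hle : Real.exp (-(2 / Λ) * Real.exp (2 * β * m + X))
      ≤ Real.exp (-2) * Real.exp (-(N + 2 * β * s)) := by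
    rw [← Real.exp_add]
    refine Real.exp_le_exp.2 ?_
    have h0 : 0 ≤ 2 + N + 2 * β * s := by positivity
    have e : -(2 / Λ) * Real.exp (2 * β * m + X) = -2 * (Real.exp (2 * β * m + X) / Λ) := by ring
    rw [e]; linarith
  refine hle.trans_lt ?_
  exact mul_lt_mul h4 (exp_le_gibbsOn hβ J hx) (Real.exp_pos _) (by norm_num)

lemma card_bond (N : ℕ) : Fintype.card (Bond N) = N.choose 2 := by
  rw [Fintype.card_subtype, Nat.choose_two_right, ← Finset.sum_range_id]
  rw [Finset.card_filter, Fintype.sum_prod_type_right, Finset.sum_range]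
  refine Finset.sum_congr rfl fun j _ => ?_
  rw [← Finset.card_filter]
  rw [← Fin.card_Iio]
  congr 1
  ext i
  simp

lemma card_bond_le (N : ℕ) : Fintype.card (Bond N) ≤ N ^ 2 := by
  refine (Fintype.card_subtype_le _).trans_eq ?_
  simp [sq]

lemma exists_strictAnti_enumeration (J : Couplings N) (h : Function.Injective fun b => |J b|) :
    ∃ e : Fin (N.choose 2) ≃ Bond N, StrictAnti fun k => |J (e k)| := by
  have h' : Function.Injective fun b => OrderDual.toDual |J b| := fun b c hbc => h hbc
  let o : LinearOrder (Bond N) := LinearOrder.lift' (fun b => OrderDual.toDual |J b|) h'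
  let e := @Fintype.orderIsoFinOfCardEq (Bond N) o _ _ (card_bond N)
  refine ⟨e.toEquiv, fun i j hij => ?_⟩
  exact (@OrderIso.lt_iff_lt (Fin (N.choose 2)) (Bond N) _
    o.toPartialOrder.toPreorder e i j).2 hij

lemma VertexDisjoint.symm {b c : Bond N} (h : VertexDisjoint b c) : VertexDisjoint c b :=
  ⟨h.1.symm, h.2.2.1.symm, h.2.1.symm, h.2.2.2.symm⟩

open Classical in
/-- Ordered pairs of distinct bonds with a common vertex. -/
noncomputable def adjacentPairs (N : ℕ) : Finset (Bond N × Bond N) :=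
  Finset.univ.filter fun p => p.1 ≠ p.2 ∧ ¬ VertexDisjoint p.1 p.2

lemma mem_adjacentPairs {p : Bond N × Bond N} :
    p ∈ adjacentPairs N ↔ p.1 ≠ p.2 ∧ ¬ VertexDisjoint p.1 p.2 := by
  simp [adjacentPairs]

/-- The bonds of weight at least `s` are pairwise vertex-disjoint. -/
def NoAdjacentAbove (s : ℝ) (J : Couplings N) : Prop :=
  ∀ p ∈ adjacentPairs N, ¬ (s ≤ |J p.1| ∧ s ≤ |J p.2|)

/-- The ordered pairs of adjacent bonds both of which have weight at least `s`. -/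
noncomputable def adjacentPairsAbove (s : ℝ) (J : Couplings N) : Finset (Bond N × Bond N) :=
  (adjacentPairs N).filter fun p => s ≤ |J p.1| ∧ s ≤ |J p.2|

/-- The typical disorder: distinct weights, a controlled total weight `W` of the bonds below `s`,
at most `n` adjacent pairs above `s`, none of them above `u`, and no weight above `w`. -/
structure TypicalDisorder (s u w W n : ℝ) (J : Couplings N) : Prop where
  injective : Function.Injective fun b => |J b|
  small_sum : ∑ b, (if |J b| < s then |J b| else 0) ≤ W
  card_pairs : ((adjacentPairsAbove s J).card : ℝ) ≤ n
  no_adjacent : NoAdjacentAbove u J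
  bounded : ∀ b, |J b| ≤ w

/-- Removing from the bonds of weight at least `s` the lighter bond of each adjacent pair
leaves a matching that carries all but a small part of the total weight. -/
lemma exists_matching {s u w W n : ℝ} {J : Couplings N} (h : TypicalDisorder s u w W n J)
    (hu : 0 ≤ u) :
    ∃ M : Finset (Bond N), (∀ b ∈ M, ∀ c ∈ M, b ≠ c → VertexDisjoint b c) ∧
      ∑ b ∈ Mᶜ, |J b| ≤ W + n * u := by
  classical
  set M : Finset (Bond N) := Finset.univ.filter fun b =>
    s ≤ |J b| ∧ ∀ c, s ≤ |J c| → (b, c) ∈ adjacentPairs N → |J c| < |J b| with hMdef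
  have hMm : ∀ b, b ∈ M ↔
      s ≤ |J b| ∧ ∀ c, s ≤ |J c| → (b, c) ∈ adjacentPairs N → |J c| < |J b| := by
    simp [hMdef]
  refine ⟨M, ?_, ?_⟩
  · intro b hb c hc hne
    rw [hMm] at hb hc
    by_contra hd
    have h1 := hb.2 c hc.1 (mem_adjacentPairs.2 ⟨hne, hd⟩)
    have h2 := hc.2 b hb.1 (mem_adjacentPairs.2 ⟨hne.symm, fun h => hd h.symm⟩)
    exact lt_asymm h1 h2
  · set P := (adjacentPairsAbove s J).image Prod.fst with hP
    have hremoved : ∀ b ∈ Mᶜ, |J b| ≤ (if |J b| < s then |J b| else 0)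
        + if b ∈ P then u else 0 := by
      intro b hb
      rw [Finset.mem_compl, hMm] at hb
      by_cases hs : |J b| < s
      · rw [if_pos hs]; split_ifs <;> linarith
      · rw [not_lt] at hs
        push Not at hb
        obtain ⟨c, hc, hadj, hcb⟩ := hb hs
        have hbP : b ∈ P := by
          rw [hP, Finset.mem_image]
          exact ⟨(b, c), by simp [adjacentPairsAbove, hadj, hs, hc], rfl⟩
        rw [if_neg (not_lt.2 hs), if_pos hbP, zero_add]
        by_contra hlt
        rw [not_le] at hlt
        exact h.no_adjacent _ hadj ⟨hlt.le, hlt.le.trans hcb⟩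
    have hcard : (P.card : ℝ) ≤ n :=
      le_trans (by exact_mod_cast Finset.card_image_le) h.card_pairs
    calc ∑ b ∈ Mᶜ, |J b|
        ≤ ∑ b ∈ Mᶜ, ((if |J b| < s then |J b| else 0) + if b ∈ P then u else 0) :=
          Finset.sum_le_sum hremoved
      _ ≤ ∑ b, ((if |J b| < s then |J b| else 0) + if b ∈ P then u else 0) := by
          refine Finset.sum_le_univ_sum_of_nonneg fun b => add_nonneg ?_ ?_
          · split_ifs
            exacts [abs_nonneg _, le_rfl]
          · split_ifs
            exacts [hu, le_rfl]
      _ = ∑ b, (if |J b| < s then |J b| else 0) + P.card * u := by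
          rw [Finset.sum_add_distrib, Finset.sum_ite_mem, Finset.univ_inter, Finset.sum_const,
            nsmul_eq_mul]
      _ ≤ W + n * u := add_le_add h.small_sum (mul_le_mul_of_nonneg_right hcard hu)

lemma card_largeBonds_lt {β a γ : ℝ} {J : Couplings N} (hN : 3 ≤ N)
    (h : ∀ b ∈ largeBonds β a γ J, ∀ c ∈ largeBonds β a γ J, b ≠ c → VertexDisjoint b c) :
    (largeBonds β a γ J).card < N.choose 2 := by
  rw [← card_bond]
  let b : Bond N := ⟨(⟨0, by omega⟩, ⟨1, by omega⟩), by simp⟩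
  let c : Bond N := ⟨(⟨0, by omega⟩, ⟨2, by omega⟩), by simp⟩
  have hbc : b ≠ c := by simp [b, c]
  by_cases hb : b ∈ largeBonds β a γ J
  · refine Finset.card_lt_univ_of_notMem (x := c) fun hc => ?_
    exact (h b hb c hc hbc).1 rfl
  · exact Finset.card_lt_univ_of_notMem hb

/-- Polynomial factors and `4 ^ N` are absorbed by `exp (3 N)`. -/
lemma eventually_poly_le_exp (β p : ℝ) (hβ : 0 < β) (hp : 0 < p) :
    ∀ᶠ N : ℕ in atTop, 8 * (N : ℝ) ^ 2 * 4 ^ N * (2 + N + 2 * β * ((N : ℝ) ^ 2 * (N : ℝ) ^ p))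
      ≤ Real.exp (3 * N) := by
  have h1 := (isLittleO_rpow_exp_pos_mul_atTop (4 + p) one_pos).def
    (c := 1 / (8 * (3 + 2 * β))) (by positivity)
  have h2 := (tendsto_natCast_atTop_atTop (R := ℝ)).eventually h1
  filter_upwards [h2, eventually_ge_atTop 1] with N hN hN1
  have hN1' : (1 : ℝ) ≤ N := by exact_mod_cast hN1
  have hN0 : (0 : ℝ) < N := by linarith
  rw [Real.norm_of_nonneg (by positivity), Real.norm_of_nonneg (by positivity), one_mul,
    Real.rpow_add hN0, one_div_mul_eq_div, le_div_iff₀ (by positivity)] at hN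
  have hp1 : 1 ≤ (N : ℝ) ^ p := Real.one_le_rpow hN1' hp.le
  have e4 : (N : ℝ) ^ (4 : ℝ) = (N : ℝ) ^ 2 * (N : ℝ) ^ 2 := by
    rw [← pow_add]; exact_mod_cast Real.rpow_natCast (N : ℝ) 4
  rw [e4] at hN
  have h3 : 2 + (N : ℝ) ≤ 3 * ((N : ℝ) ^ 2 * (N : ℝ) ^ p) := by
    nlinarith [mul_le_mul_of_nonneg_left hp1 (sq_nonneg (N : ℝ))]
  have h4 : (4 : ℝ) ^ N ≤ Real.exp (2 * N) := by
    calc (4 : ℝ) ^ N ≤ Real.exp 2 ^ N := by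
          gcongr
          have : Real.exp 2 = Real.exp 1 ^ 2 := by rw [← Real.exp_nat_mul]; norm_num
          rw [this]; nlinarith [Real.exp_one_gt_d9]
      _ = Real.exp (2 * N) := by rw [← Real.exp_nat_mul]; ring_nf
  calc 8 * (N : ℝ) ^ 2 * 4 ^ N * (2 + N + 2 * β * ((N : ℝ) ^ 2 * (N : ℝ) ^ p))
      ≤ 8 * (N : ℝ) ^ 2 * Real.exp (2 * N) * (3 * ((N : ℝ) ^ 2 * (N : ℝ) ^ p)
          + 2 * β * ((N : ℝ) ^ 2 * (N : ℝ) ^ p)) := by gcongr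
    _ = ((N : ℝ) ^ 2 * (N : ℝ) ^ 2 * (N : ℝ) ^ p * (8 * (3 + 2 * β))) * Real.exp (2 * N) := by
        ring
    _ ≤ Real.exp N * Real.exp (2 * N) := by gcongr
    _ = Real.exp (3 * N) := by rw [← Real.exp_add]; congr 1; ring

/-- For a typical disorder, the mixing-time bound holds for every number `L` of frozen
bonds. -/
theorem restrictedMixingTime_le_of_typical {s u w W n β D κ : ℝ} {J : Couplings N}
    (h : TypicalDisorder s u w W n J) (hN : 1 ≤ N) (hβ : 0 < β) (hu : 0 ≤ u)
    (hpoly : 8 * (N : ℝ) ^ 2 * 4 ^ N * (2 + N + 2 * β * ((N : ℝ) ^ 2 * w)) ≤ Real.exp (3 * N))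
    (hD : 4 * β * (W + n * u) + 3 * N ≤ D * (N : ℝ) ^ κ)
    {e : Fin (N.choose 2) ≃ Bond N} (he : StrictAnti fun k => |J (e k)|)
    (L : Fin (N.choose 2)) (η : Config N) :
    restrictedMixingTime β J (topVertices e L) η
      ≤ ENNReal.ofReal (Real.exp (2 * β * |J (e L)| + D * (N : ℝ) ^ κ)) := by
  obtain ⟨M, hM, hR⟩ := exists_matching h hu
  refine restrictedMixingTime_le hN hM J hβ.le (abs_nonneg _) ?_ η ?_
  · intro b _ hb1 _
    have hL : L ≤ e.symm b := by
      by_contra hlt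
      rw [not_le] at hlt
      exact hb1 (by
        simp only [topVertices, Finset.mem_filter, Finset.mem_univ, true_and]
        exact ⟨e.symm b, hlt, Or.inl (by simp)⟩)
    simpa using he.antitone hL
  · have hsum : ∑ b, |J b| ≤ (N : ℝ) ^ 2 * w := by
      have hw : 0 ≤ w := (abs_nonneg _).trans (h.bounded (e L))
      calc ∑ b, |J b| ≤ ∑ _b : Bond N, w := Finset.sum_le_sum fun b _ => h.bounded b
        _ = (Fintype.card (Bond N) : ℝ) * w := by
            rw [Finset.sum_const, nsmul_eq_mul, Finset.card_univ]
        _ ≤ (N : ℝ) ^ 2 * w := by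
            gcongr
            exact_mod_cast card_bond_le N
    calc 8 * (N : ℝ) ^ 2 * 4 ^ N * (2 + N + 2 * β * ∑ b, |J b|)
        ≤ 8 * (N : ℝ) ^ 2 * 4 ^ N * (2 + N + 2 * β * ((N : ℝ) ^ 2 * w)) := by gcongr
      _ ≤ Real.exp (3 * N) := hpoly
      _ ≤ Real.exp (D * (N : ℝ) ^ κ - 4 * β * ∑ b ∈ Mᶜ, |J b|) := by
          refine Real.exp_le_exp.2 ?_
          have : 4 * β * ∑ b ∈ Mᶜ, |J b| ≤ 4 * β * (W + n * u) := by gcongr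
          linarith

end Typical

/-! ### Probability estimates for the couplings -/

section Couplings

lemma lintegral_comp_abs (φ : ℝ → ℝ≥0∞) :
    ∫⁻ x, φ |x| = 2 * ∫⁻ x in Set.Ioi 0, φ x := by
  have hpos : ∫⁻ x in Set.Ioi (0 : ℝ), φ |x| = ∫⁻ x in Set.Ioi 0, φ x :=
    setLIntegral_congr_fun measurableSet_Ioi fun x hx => by
      rw [abs_of_pos (Set.mem_Ioi.1 hx)]
  -- The negative half-line is mapped to the positive one by the reflection `x ↦ -x`.
  have hneg : ∫⁻ x in Set.Iio (0 : ℝ), φ |x| = ∫⁻ x in Set.Ioi 0, φ |x| := by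
    rw [← lintegral_indicator measurableSet_Iio, ← lintegral_indicator measurableSet_Ioi,
      ← lintegral_neg_eq_self]
    refine lintegral_congr fun x => ?_
    simp [Set.indicator_apply]
  rw [← lintegral_add_compl _ (measurableSet_Ioi (a := (0 : ℝ))), Set.compl_Ioi,
    setLIntegral_congr Iio_ae_eq_Iic.symm, hneg, hpos, two_mul]

/-- The absolute value of a coupling has the Pareto density
`α / N * x ^ (-(1 + α))` on `x ≥ N ^ (-1/α)`. -/
lemma lintegral_abs_couplingLaw {α : ℝ} (hα : 0 < α) {N : ℕ} (hN : 1 ≤ N) {φ : ℝ → ℝ≥0∞}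
    (hφ : Measurable φ) :
    ∫⁻ x, φ |x| ∂(couplingLaw α N)
      = ∫⁻ x in Set.Ici ((N : ℝ) ^ (-(1 / α))),
          ENNReal.ofReal (α / N * x ^ (-(1 + α))) * φ x := by
  have hN0 : (0 : ℝ) < N := by exact_mod_cast hN
  set c := (N : ℝ) ^ (-(1 / α)) with hc
  have hc0 : 0 < c := Real.rpow_pos_of_pos hN0 _
  have hmeas : Measurable fun x : ℝ => ENNReal.ofReal
      (if c ≤ |x| then α / (2 * (N : ℝ)) * |x| ^ (-(1 + α)) else 0) := by
    refine ENNReal.measurable_ofReal.comp (Measurable.ite ?_ ?_ measurable_const)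
    · exact measurableSet_le measurable_const measurable_norm
    · fun_prop
  have h2 : (2 : ℝ≥0∞) = ENNReal.ofReal 2 := by simp
  rw [couplingLaw, lintegral_withDensity_eq_lintegral_mul _ hmeas (by fun_prop)]
  simp only [Pi.mul_apply]
  rw [lintegral_comp_abs (fun y => ENNReal.ofReal
      (if c ≤ y then α / (2 * (N : ℝ)) * y ^ (-(1 + α)) else 0) * φ y),
    ← lintegral_const_mul' _ _ (by simp), ← lintegral_indicator measurableSet_Ioi,
    ← lintegral_indicator measurableSet_Ici]
  refine lintegral_congr fun x => ?_
  simp only [Set.indicator_apply, Set.mem_Ioi, Set.mem_Ici]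
  by_cases hx : c ≤ x
  · have hx0 : 0 < x := hc0.trans_le hx
    rw [if_pos hx0, if_pos hx, if_pos hx, ← mul_assoc, h2, ← ENNReal.ofReal_mul (by norm_num)]
    congr 2
    field_simp
  · simp [hx]

lemma lintegral_Ioi_pareto {α : ℝ} (hα : 0 < α) {N : ℕ} {s : ℝ} (hs : 0 < s) :
    ∫⁻ x in Set.Ioi s, ENNReal.ofReal (α / N * x ^ (-(1 + α)))
      = ENNReal.ofReal (s ^ (-α) / N) := by
  have hint := (integrableOn_Ioi_rpow_of_lt (a := -(1 + α)) (by linarith) hs).const_mul (α / N)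
  rw [← ofReal_integral_eq_lintegral_ofReal hint, integral_const_mul,
    integral_Ioi_rpow_of_lt (by linarith) hs]
  · congr 1
    have : -(1 + α) + 1 = -α := by ring
    rw [this]
    field_simp
  · filter_upwards [ae_restrict_mem measurableSet_Ioi] with x hx
    have : 0 < x := hs.trans hx
    positivity

lemma isProbabilityMeasure_couplingLaw {α : ℝ} (hα : 0 < α) {N : ℕ} (hN : 1 ≤ N) :
    IsProbabilityMeasure (couplingLaw α N) := by
  have hN0 : (0 : ℝ) < N := by exact_mod_cast hN
  constructor
  have h := lintegral_abs_couplingLaw hα hN (φ := fun _ => 1) measurable_const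
  simp only [lintegral_const, one_mul, mul_one] at h
  rw [h, setLIntegral_congr Ioi_ae_eq_Ici.symm,
    lintegral_Ioi_pareto hα (Real.rpow_pos_of_pos hN0 _), ← Real.rpow_mul hN0.le]
  have : -(1 / α) * -α = 1 := by field_simp
  rw [this, Real.rpow_one, div_self hN0.ne', ENNReal.ofReal_one]

lemma couplingLaw_tail {α : ℝ} (hα : 0 < α) {N : ℕ} (hN : 1 ≤ N) {s : ℝ} (hs : 0 < s) :
    couplingLaw α N {x | s ≤ |x|} ≤ ENNReal.ofReal (s ^ (-α) / N) := by
  have hm : MeasurableSet {x : ℝ | s ≤ |x|} := measurableSet_le measurable_const measurable_norm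
  have h := lintegral_abs_couplingLaw hα hN (φ := (Set.Ici s).indicator 1)
    (measurable_one.indicator measurableSet_Ici)
  have h1 : ∫⁻ x, (Set.Ici s).indicator (1 : ℝ → ℝ≥0∞) |x| ∂(couplingLaw α N)
      = couplingLaw α N {x | s ≤ |x|} := by
    rw [← lintegral_indicator_one hm]
    rfl
  rw [← h1, h, ← lintegral_Ioi_pareto hα hs, setLIntegral_congr (Ioi_ae_eq_Ici (a := s)),
    ← lintegral_indicator measurableSet_Ici (μ := volume) (s := Set.Ici s)]
  refine (setLIntegral_le_lintegral _ _).trans (lintegral_mono fun x => ?_)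
  by_cases hx : x ∈ Set.Ici s <;> simp [hx]

/-- The truncated first moment of one coupling. -/
lemma lintegral_couplingLaw_truncated {α : ℝ} (hα0 : 0 < α) (hα1 : α < 1) {N : ℕ} (hN : 1 ≤ N)
    {s : ℝ} (hs : 0 < s) :
    ∫⁻ x, ENNReal.ofReal (if |x| < s then |x| else 0) ∂(couplingLaw α N)
      ≤ ENNReal.ofReal (α / (1 - α) * s ^ (1 - α) / N) := by
  have hN0 : (0 : ℝ) < N := by exact_mod_cast hN
  have hmeas : Measurable fun y : ℝ => ENNReal.ofReal (if y < s then y else 0) :=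
    ENNReal.measurable_ofReal.comp
      (Measurable.ite measurableSet_Iio measurable_id measurable_const)
  rw [lintegral_abs_couplingLaw hα0 hN hmeas]
  have hint : IntegrableOn (fun x : ℝ => α / N * x ^ (-α)) (Set.Ioo 0 s) :=
    ((intervalIntegral.integrableOn_Ioo_rpow_iff hs).2 (by linarith)).const_mul _
  have hval : ∫⁻ x in Set.Ioo 0 s, ENNReal.ofReal (α / N * x ^ (-α))
      = ENNReal.ofReal (α / (1 - α) * s ^ (1 - α) / N) := by
    rw [← ofReal_integral_eq_lintegral_ofReal hint, integral_const_mul,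
      ← integral_Ioc_eq_integral_Ioo, ← intervalIntegral.integral_of_le hs.le,
      integral_rpow (Or.inl (by linarith))]
    · congr 1
      have h1 : -α + 1 = 1 - α := by ring
      rw [h1, Real.zero_rpow (by linarith)]
      have : 1 - α ≠ 0 := by linarith
      field_simp
      ring
    · filter_upwards [ae_restrict_mem measurableSet_Ioo] with x hx
      have : 0 < x := hx.1
      positivity
  rw [← hval, ← lintegral_indicator measurableSet_Ici, ← lintegral_indicator measurableSet_Ioo]
  refine lintegral_mono fun x => ?_
  simp only [Set.indicator_apply, Set.mem_Ici, Set.mem_Ioo]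
  by_cases hx : (N : ℝ) ^ (-(1 / α)) ≤ x
  · have hx0 : 0 < x := (Real.rpow_pos_of_pos hN0 _).trans_le hx
    by_cases hxs : x < s
    · rw [if_pos hx, if_pos hxs, if_pos ⟨hx0, hxs⟩, ← ENNReal.ofReal_mul (by positivity)]
      refine ENNReal.ofReal_le_ofReal (le_of_eq ?_)
      have : x ^ (-α) = x ^ (-(1 + α)) * x := by
        rw [← Real.rpow_add_one hx0.ne']; congr 1; ring
      rw [this]; ring
    · simp [hxs]
  · rw [if_neg hx]; exact zero_le

variable {N : ℕ}

lemma isProbabilityMeasure_disorderLaw {α : ℝ} (hα : 0 < α) (hN : 1 ≤ N) :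
    IsProbabilityMeasure (disorderLaw α N) := by
  have := isProbabilityMeasure_couplingLaw hα hN
  unfold disorderLaw
  infer_instance

lemma disorderLaw_eval {α : ℝ} (hα : 0 < α) (hN : 1 ≤ N) (b : Bond N) {T : Set ℝ}
    (hT : MeasurableSet T) :
    disorderLaw α N {J | J b ∈ T} = couplingLaw α N T := by
  have := isProbabilityMeasure_couplingLaw hα hN
  exact (measurePreserving_eval (fun _ : Bond N => couplingLaw α N) b).measure_preimage
    hT.nullMeasurableSet

lemma disorderLaw_pair {α : ℝ} (hα : 0 < α) (hN : 1 ≤ N) {b c : Bond N} (hbc : b ≠ c)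
    (T : Set ℝ) :
    disorderLaw α N {J | J b ∈ T ∧ J c ∈ T} = couplingLaw α N T ^ 2 := by
  have := isProbabilityMeasure_couplingLaw hα hN
  have hset : {J : Couplings N | J b ∈ T ∧ J c ∈ T}
      = Set.pi Set.univ fun i => if i ∈ ({b, c} : Finset (Bond N)) then T else Set.univ := by
    ext J
    simp only [Set.mem_ofPred_eq, Set.mem_pi, Set.mem_univ, true_imp_iff]
    refine ⟨fun h i => ?_, fun h => ⟨?_, ?_⟩⟩
    · split_ifs with hi
      · rcases Finset.mem_insert.1 hi with rfl | hi
        · exact h.1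
        · rw [Finset.mem_singleton.1 hi]; exact h.2
      · trivial
    · simpa using h b
    · simpa using h c
  rw [hset, disorderLaw, Measure.pi_pi]
  have : ∀ i : Bond N, couplingLaw α N (if i ∈ ({b, c} : Finset (Bond N)) then T else Set.univ)
      = if i ∈ ({b, c} : Finset (Bond N)) then couplingLaw α N T else 1 := by
    intro i; split_ifs
    · rfl
    · exact measure_univ
  simp only [this]
  rw [Finset.prod_ite_mem, Finset.univ_inter, Finset.prod_pair hbc, sq]

lemma disorderLaw_abs_eq {α : ℝ} (hα : 0 < α) (hN : 1 ≤ N) {b c : Bond N} (hbc : b ≠ c) :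
    disorderLaw α N {J | |J b| = |J c|} = 0 := by
  have := isProbabilityMeasure_couplingLaw hα hN
  have := isProbabilityMeasure_disorderLaw hα hN
  have hind : ProbabilityTheory.IndepFun (fun J : Couplings N => J b) (fun J => J c)
      (disorderLaw α N) :=
    (ProbabilityTheory.iIndepFun_pi (X := fun _ : Bond N => id)
      (μ := fun _ => couplingLaw α N) fun _ => aemeasurable_id).indepFun hbc
  have hmap := (ProbabilityTheory.indepFun_iff_map_prod_eq_prod_map_map
    (measurable_pi_apply b).aemeasurable (measurable_pi_apply c).aemeasurable).1 hind
  have he : ∀ d : Bond N, (disorderLaw α N).map (fun J => J d) = couplingLaw α N := fun d =>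
    (measurePreserving_eval (fun _ : Bond N => couplingLaw α N) d).map_eq
  rw [he, he] at hmap
  have hm : MeasurableSet {p : ℝ × ℝ | |p.1| = |p.2|} :=
    measurableSet_eq_fun (by fun_prop) (by fun_prop)
  have hpre : disorderLaw α N {J | |J b| = |J c|}
      = (disorderLaw α N).map (fun J => (J b, J c)) {p : ℝ × ℝ | |p.1| = |p.2|} := by
    rw [Measure.map_apply (by fun_prop) hm]; rfl
  rw [hpre, hmap, Measure.measure_prod_null hm]
  refine Eventually.of_forall fun x => ?_
  have hfin : (Prod.mk x ⁻¹' {p : ℝ × ℝ | |p.1| = |p.2|}).Finite := by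
    refine (Set.toFinite {x, -x}).subset fun y hy => ?_
    rcases abs_eq_abs.1 (hy : |x| = |y|) with h | h
    · left; exact h.symm
    · right; exact (neg_eq_iff_eq_neg.2 h).symm
  exact withDensity_absolutelyContinuous _ _ (hfin.measure_zero volume)

lemma disorderLaw_not_injective {α : ℝ} (hα : 0 < α) (hN : 1 ≤ N) :
    disorderLaw α N {J | ¬ Function.Injective fun b => |J b|} = 0 := by
  have : {J : Couplings N | ¬ Function.Injective fun b => |J b|}
      ⊆ ⋃ b, ⋃ c, ⋃ _ : b ≠ c, {J | |J b| = |J c|} := by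
    intro J hJ
    rw [Set.mem_ofPred_eq, Function.not_injective_iff] at hJ
    obtain ⟨b, c, h, hne⟩ := hJ
    simp only [Set.mem_iUnion]
    exact ⟨b, c, hne, h⟩
  refine measure_mono_null this ?_
  simp only [measure_iUnion_null_iff]
  exact fun b c h => disorderLaw_abs_eq hα hN h

lemma card_adjacentPairs_le (N : ℕ) : (adjacentPairs N).card ≤ 4 * N ^ 3 := by
  have h : (adjacentPairs N).card
      ≤ (Finset.univ : Finset (Fin N × Fin N × Fin N × Fin 4)).card := by
    -- An adjacent pair is determined by the first bond, the endpoint of the second bond that is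
    -- not the common vertex, and a code for which endpoints coincide.
    refine Finset.card_le_card_of_injOn
      (fun p => if p.1.1.1 = p.2.1.1 then (p.1.1.1, p.1.1.2, p.2.1.2, 0)
        else if p.1.1.1 = p.2.1.2 then (p.1.1.1, p.1.1.2, p.2.1.1, 1)
        else if p.1.1.2 = p.2.1.1 then (p.1.1.1, p.1.1.2, p.2.1.2, 2)
        else (p.1.1.1, p.1.1.2, p.2.1.1, 3)) (fun _ _ => Finset.mem_univ _) ?_
    rintro ⟨⟨⟨b1, b2⟩, hb⟩, ⟨⟨c1, c2⟩, hc⟩⟩ hp ⟨⟨⟨b1', b2'⟩, hb'⟩, ⟨⟨c1', c2'⟩, hc'⟩⟩ hq h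
    have hp := (mem_adjacentPairs.1 hp).2
    have hq := (mem_adjacentPairs.1 hq).2
    simp only [VertexDisjoint] at hp hq
    simp only at h
    split_ifs at h <;> simp_all
  refine h.trans_eq ?_
  simp; ring

/-- The expected number of ordered adjacent pairs with both weights at least `s`. -/
lemma sum_adjacentPairs_le {α : ℝ} (hα : 0 < α) (hN : 1 ≤ N) {s : ℝ} (hs : 0 < s) :
    ∑ p ∈ adjacentPairs N, disorderLaw α N {J | s ≤ |J p.1| ∧ s ≤ |J p.2|}
      ≤ ENNReal.ofReal (4 * N * (s ^ (-α)) ^ 2) := by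
  have hN0 : (0 : ℝ) < N := by exact_mod_cast hN
  calc ∑ p ∈ adjacentPairs N, disorderLaw α N {J | s ≤ |J p.1| ∧ s ≤ |J p.2|}
      ≤ ∑ p ∈ adjacentPairs N, ENNReal.ofReal ((s ^ (-α) / N) ^ 2) := by
        refine Finset.sum_le_sum fun p hp => ?_
        refine (disorderLaw_pair hα hN (mem_adjacentPairs.1 hp).1 {x | s ≤ |x|}).trans_le ?_
        rw [ENNReal.ofReal_pow (by positivity)]
        exact pow_le_pow_left' (couplingLaw_tail hα hN hs) 2
    _ = ENNReal.ofReal ((adjacentPairs N).card * (s ^ (-α) / N) ^ 2) := by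
        rw [Finset.sum_const, nsmul_eq_mul, ENNReal.ofReal_mul (by positivity),
          ENNReal.ofReal_natCast]
    _ ≤ ENNReal.ofReal (4 * N ^ 3 * (s ^ (-α) / N) ^ 2) := by
        gcongr
        exact_mod_cast card_adjacentPairs_le N
    _ = ENNReal.ofReal (4 * N * (s ^ (-α)) ^ 2) := by
        congr 1; field_simp

lemma disorderLaw_not_noAdjacentAbove {α : ℝ} (hα : 0 < α) (hN : 1 ≤ N) {s : ℝ} (hs : 0 < s) :
    disorderLaw α N {J | ¬ NoAdjacentAbove s J} ≤ ENNReal.ofReal (4 * N * (s ^ (-α)) ^ 2) := by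
  refine le_trans ?_ (sum_adjacentPairs_le hα hN hs)
  refine (measure_mono ?_).trans (measure_biUnion_finset_le (adjacentPairs N) _)
  intro J hJ
  simp only [Set.mem_ofPred_eq, NoAdjacentAbove, not_forall, not_not] at hJ
  obtain ⟨p, hp, h⟩ := hJ
  simp only [Set.mem_iUnion]
  exact ⟨p, hp, h⟩

lemma disorderLaw_card_adjacentPairsAbove {α : ℝ} (hα : 0 < α) (hN : 1 ≤ N) {s n : ℝ}
    (hs : 0 < s) (hn : 0 < n) :
    disorderLaw α N {J | n < (adjacentPairsAbove s J).card}
      ≤ ENNReal.ofReal (4 * N * (s ^ (-α)) ^ 2 / n) := by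
  have hm : ∀ p : Bond N × Bond N, MeasurableSet {J : Couplings N | s ≤ |J p.1| ∧ s ≤ |J p.2|} :=
    fun p => (measurableSet_le (f := fun _ => s) (g := fun J : Couplings N => |J p.1|)
      (by fun_prop) (by fun_prop)).inter (measurableSet_le (f := fun _ => s)
      (g := fun J : Couplings N => |J p.2|) (by fun_prop) (by fun_prop))
  set f : Couplings N → ℝ≥0∞ := fun J => ∑ p ∈ adjacentPairs N,
    {J : Couplings N | s ≤ |J p.1| ∧ s ≤ |J p.2|}.indicator 1 J with hf
  have hfm : Measurable f := Finset.measurable_fun_sum _ fun p _ =>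
    measurable_one.indicator (hm p)
  have hfe : ∀ J, f J = (adjacentPairsAbove s J).card := by
    intro J
    simp only [hf, adjacentPairsAbove, Finset.card_filter, Nat.cast_sum, Set.indicator_apply,
      Set.mem_ofPred_eq, Pi.one_apply, Nat.cast_ite, Nat.cast_one, Nat.cast_zero]
  have hint : ∫⁻ J, f J ∂(disorderLaw α N) ≤ ENNReal.ofReal (4 * N * (s ^ (-α)) ^ 2) := by
    rw [lintegral_finsetSum _ fun p _ => measurable_one.indicator (hm p)]
    simp only [lintegral_indicator_one (hm _)]
    exact sum_adjacentPairs_le hα hN hs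
  rw [ENNReal.ofReal_div_of_pos hn]
  refine le_trans ?_ (ENNReal.div_le_div_right hint _)
  refine le_trans (measure_mono ?_) (meas_ge_le_lintegral_div hfm.aemeasurable
    (ENNReal.ofReal_pos.2 hn).ne' ENNReal.ofReal_ne_top)
  intro J hJ
  rw [Set.mem_ofPred_eq] at hJ ⊢
  rw [hfe, ← ENNReal.ofReal_natCast]
  exact ENNReal.ofReal_le_ofReal hJ.le

lemma disorderLaw_unbounded {α : ℝ} (hα : 0 < α) (hN : 1 ≤ N) {w : ℝ} (hw : 0 < w) :
    disorderLaw α N {J | ¬ ∀ b, |J b| ≤ w} ≤ ENNReal.ofReal (N * w ^ (-α)) := by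
  have hN0 : (0 : ℝ) < N := by exact_mod_cast hN
  calc disorderLaw α N {J | ¬ ∀ b, |J b| ≤ w}
      ≤ ∑ b : Bond N, disorderLaw α N {J | J b ∈ {x : ℝ | w ≤ |x|}} := by
        refine (measure_mono ?_).trans (measure_biUnion_finset_le Finset.univ _)
        intro J hJ
        simp only [Set.mem_ofPred_eq, not_forall, not_le] at hJ
        obtain ⟨b, hb⟩ := hJ
        simp only [Set.mem_iUnion]
        exact ⟨b, Finset.mem_univ b, hb.le⟩
    _ ≤ ∑ _b : Bond N, ENNReal.ofReal (w ^ (-α) / N) := by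
        refine Finset.sum_le_sum fun b _ => ?_
        have hm : MeasurableSet {x : ℝ | w ≤ |x|} :=
          measurableSet_le measurable_const measurable_norm
        rw [disorderLaw_eval hα hN b hm]
        exact couplingLaw_tail hα hN hw
    _ = ENNReal.ofReal (Fintype.card (Bond N) * (w ^ (-α) / N)) := by
        rw [Finset.sum_const, nsmul_eq_mul, ENNReal.ofReal_mul (by positivity),
          ENNReal.ofReal_natCast, Finset.card_univ]
    _ ≤ ENNReal.ofReal ((N : ℝ) ^ 2 * (w ^ (-α) / N)) := by
        gcongr
        exact_mod_cast card_bond_le N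
    _ = ENNReal.ofReal (N * w ^ (-α)) := by congr 1; field_simp

/-- Chebyshev's inequality for the total weight of the light bonds. The variance of a weight
truncated at `s` is at most `s` times its mean. -/
lemma disorderLaw_small_sum {α : ℝ} (hα0 : 0 < α) (hα1 : α < 1) (hN : 1 ≤ N) {s x : ℝ}
    (hs : 0 < s) (hx : 0 < x) :
    disorderLaw α N {J | N * (α / (1 - α) * s ^ (1 - α)) + x
        < ∑ b, (if |J b| < s then |J b| else 0)}
      ≤ ENNReal.ofReal (N * (α / (1 - α) * s ^ (1 - α)) * s / x ^ 2) := by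
  have hμ := isProbabilityMeasure_couplingLaw hα0 hN
  have hP := isProbabilityMeasure_disorderLaw hα0 hN
  have hN0 : (0 : ℝ) < N := by exact_mod_cast hN
  have h1α : 0 < 1 - α := by linarith
  set Y : ℝ → ℝ := fun y => if |y| < s then |y| else 0 with hY
  have hYm : Measurable Y :=
    Measurable.ite (measurableSet_lt measurable_norm measurable_const) measurable_norm
      measurable_const
  have hY0 : ∀ y, 0 ≤ Y y := fun y => by
    simp only [hY]; split_ifs
    exacts [abs_nonneg _, le_rfl]
  have hYs : ∀ y, Y y ≤ s := fun y => by
    simp only [hY]; split_ifs with h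
    exacts [h.le, hs.le]
  have hbd : ∀ᵐ y ∂(couplingLaw α N), Y y ∈ Set.Icc 0 s :=
    Eventually.of_forall fun y => ⟨hY0 y, hYs y⟩
  have hLp : MemLp Y 2 (couplingLaw α N) := memLp_of_bounded hbd hYm.aestronglyMeasurable 2
  set q := α / (1 - α) * s ^ (1 - α) / N with hq
  have hq0 : 0 ≤ q := by positivity
  have hmean : ∫ y, Y y ∂(couplingLaw α N) ≤ q := by
    rw [integral_eq_lintegral_of_nonneg_ae (Eventually.of_forall hY0) hYm.aestronglyMeasurable]
    exact ENNReal.toReal_le_of_le_ofReal hq0 (lintegral_couplingLaw_truncated hα0 hα1 hN hs)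
  have hmean0 : 0 ≤ ∫ y, Y y ∂(couplingLaw α N) := integral_nonneg hY0
  have hvar : ProbabilityTheory.variance Y (couplingLaw α N) ≤ s * q := by
    refine (ProbabilityTheory.variance_le_sub_mul_sub hbd hYm.aemeasurable).trans ?_
    rw [sub_zero]
    exact mul_le_mul (by linarith) hmean hmean0 hs.le
  have hcard : (Fintype.card (Bond N) : ℝ) ≤ (N : ℝ) ^ 2 := by exact_mod_cast card_bond_le N
  set S : Couplings N → ℝ := ∑ b : Bond N, fun J => Y (J b) with hS
  have hSe : ∀ J, S J = ∑ b, Y (J b) := fun J => by simp [hS]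
  have hLpb : ∀ b : Bond N, MemLp (fun J : Couplings N => Y (J b)) 2 (disorderLaw α N) :=
    fun b => hLp.comp_measurePreserving
      (measurePreserving_eval (fun _ : Bond N => couplingLaw α N) b)
  have hSLp : MemLp S 2 (disorderLaw α N) := memLp_finsetSum' _ fun b _ => hLpb b
  have hSvar : ProbabilityTheory.variance S (disorderLaw α N) ≤ (N : ℝ) ^ 2 * (s * q) := by
    have h := ProbabilityTheory.variance_sum_pi (μ := fun _ : Bond N => couplingLaw α N)
      (X := fun _ => Y) fun _ => hLp
    calc ProbabilityTheory.variance S (disorderLaw α N)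
        = ∑ _b : Bond N, ProbabilityTheory.variance Y (couplingLaw α N) := h
      _ ≤ ∑ _b : Bond N, s * q := Finset.sum_le_sum fun _ _ => hvar
      _ = Fintype.card (Bond N) * (s * q) := by
          rw [Finset.sum_const, nsmul_eq_mul, Finset.card_univ]
      _ ≤ _ := by gcongr
  have hSmean : ∫ J, S J ∂(disorderLaw α N) ≤ (N : ℝ) ^ 2 * q := by
    have he : ∀ b : Bond N, ∫ J, Y (J b) ∂(disorderLaw α N) = ∫ y, Y y ∂(couplingLaw α N) := by
      intro b
      have hmp := measurePreserving_eval (fun _ : Bond N => couplingLaw α N) b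
      rw [← hmp.map_eq, integral_map hmp.measurable.aemeasurable hYm.aestronglyMeasurable]
      rfl
    simp only [hSe]
    rw [integral_finsetSum _ fun b _ => (hLpb b).integrable (by norm_num)]
    simp only [he]
    rw [Finset.sum_const, nsmul_eq_mul, Finset.card_univ]
    exact mul_le_mul hcard hmean hmean0 (by positivity)
  have e1 : (N : ℝ) ^ 2 * q = N * (α / (1 - α) * s ^ (1 - α)) := by
    rw [hq]; field_simp
  have e2 : (N : ℝ) ^ 2 * (s * q) = N * (α / (1 - α) * s ^ (1 - α)) * s := by
    rw [← e1]; ring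
  rw [← e2, ← e1]
  refine le_trans (measure_mono ?_)
    ((ProbabilityTheory.meas_ge_le_variance_div_sq hSLp hx).trans
      (ENNReal.ofReal_le_ofReal (div_le_div_of_nonneg_right hSvar (by positivity))))
  intro J hJ
  rw [Set.mem_ofPred_eq] at hJ ⊢
  refine le_trans ?_ (le_abs_self _)
  rw [hSe]
  change _ < ∑ b, Y (J b) at hJ
  linarith

end Couplings

/-! ### Typical disorder has probability tending to one -/

lemma tendsto_ofReal_const_mul_rpow_neg (K : ℝ) {δ : ℝ} (hδ : 0 < δ) :
    Tendsto (fun N : ℕ => ENNReal.ofReal (K * (N : ℝ) ^ (-δ))) atTop (𝓝 0) := by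
  have h := ((tendsto_rpow_neg_atTop hδ).comp (tendsto_natCast_atTop_atTop (R := ℝ))).const_mul K
  rw [mul_zero] at h
  simpa using ENNReal.tendsto_ofReal h

/-- Disorder is typical with probability tending to one, for the scales on which the mixing-time
bound is based: `s = N ^ (1/(2α))` is where the expected number of adjacent heavy pairs is of
order one. -/
lemma tendsto_disorderLaw_atypical {α c θ : ℝ} (hα0 : 0 < α) (hα1 : α < 1) (hc : 0 < c)
    (hθ : 1 / (2 * α) < θ) :
    Tendsto (fun N : ℕ => disorderLaw α N {J | ¬ (TypicalDisorder ((N : ℝ) ^ (1 / (2 * α)))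
        ((N : ℝ) ^ (1 / (2 * α) + 1 / 4)) ((N : ℝ) ^ (2 / α))
        ((α / (1 - α) + 1) * (N : ℝ) ^ (1 / 2 + 1 / (2 * α))) ((N : ℝ) ^ (1 / 4 : ℝ)) J
        ∧ NoAdjacentAbove (c * (N : ℝ) ^ θ) J)}) atTop (𝓝 0) := by
  have hθ' : 0 < 2 * α * θ - 1 := by
    rw [div_lt_iff₀ (by positivity)] at hθ; linarith
  have hlim := ((((tendsto_ofReal_const_mul_rpow_neg (α / (1 - α)) (δ := 1 / 2)
    (by norm_num)).add (tendsto_ofReal_const_mul_rpow_neg 4 (δ := 1 / 4) (by norm_num))).add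
    (tendsto_ofReal_const_mul_rpow_neg 4 (δ := α / 2) (by linarith))).add
    (tendsto_ofReal_const_mul_rpow_neg 1 (δ := 1) (by norm_num))).add
    (tendsto_ofReal_const_mul_rpow_neg (4 * (c ^ (-α)) ^ 2) hθ')
  simp only [add_zero] at hlim
  refine tendsto_of_tendsto_of_tendsto_of_le_of_le' tendsto_const_nhds hlim
    (Eventually.of_forall fun _ => zero_le) ?_
  filter_upwards [eventually_ge_atTop 1] with N hN
  have hN0 : (0 : ℝ) < N := by exact_mod_cast hN
  have hpow : ∀ p : ℝ, 0 < (N : ℝ) ^ p := fun p => Real.rpow_pos_of_pos hN0 p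
  have hα : α ≠ 0 := hα0.ne'
  have hsq : ∀ p : ℝ, ((N : ℝ) ^ p) ^ 2 = (N : ℝ) ^ (p * 2) := fun p => by
    rw [← Real.rpow_natCast, ← Real.rpow_mul hN0.le]; norm_num
  have hone : ∀ p : ℝ, (N : ℝ) * (N : ℝ) ^ p = (N : ℝ) ^ (1 + p) := fun p => by
    rw [Real.rpow_add hN0, Real.rpow_one]
  have hmul : ∀ p q : ℝ, ((N : ℝ) ^ p) ^ q = (N : ℝ) ^ (p * q) := fun p q =>
    (Real.rpow_mul hN0.le p q).symm
  have hW : (N : ℝ) * (α / (1 - α) * ((N : ℝ) ^ (1 / (2 * α))) ^ (1 - α))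
      = α / (1 - α) * (N : ℝ) ^ (1 / 2 + 1 / (2 * α)) := by
    rw [hmul, mul_left_comm, hone]
    congr 2; field_simp; ring
  have b1 := disorderLaw_not_injective hα0 hN
  have b2 := disorderLaw_small_sum hα0 hα1 hN (hpow (1 / (2 * α))) (hpow (1 / 2 + 1 / (2 * α)))
  have b3 := disorderLaw_card_adjacentPairsAbove hα0 hN (hpow (1 / (2 * α))) (hpow (1 / 4))
  have b4 := disorderLaw_not_noAdjacentAbove hα0 hN (hpow (1 / (2 * α) + 1 / 4))
  have b5 := disorderLaw_unbounded hα0 hN (hpow (2 / α))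
  have b6 := disorderLaw_not_noAdjacentAbove hα0 hN (mul_pos hc (hpow θ))
  have e2 : α / (1 - α) * (N : ℝ) ^ (1 / 2 + 1 / (2 * α)) * (N : ℝ) ^ (1 / (2 * α))
      / ((N : ℝ) ^ (1 / 2 + 1 / (2 * α))) ^ 2 = α / (1 - α) * (N : ℝ) ^ (-(1 / 2) : ℝ) := by
    rw [hsq, mul_assoc, mul_div_assoc, ← Real.rpow_add hN0, ← Real.rpow_sub hN0]
    congr 2; ring
  have e3 : 4 * (N : ℝ) * (((N : ℝ) ^ (1 / (2 * α))) ^ (-α)) ^ 2 / (N : ℝ) ^ (1 / 4 : ℝ)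
      = 4 * (N : ℝ) ^ (-(1 / 4) : ℝ) := by
    rw [hmul, hsq, mul_assoc, hone, mul_div_assoc, ← Real.rpow_sub hN0]
    congr 2; field_simp; ring
  have e4 : 4 * (N : ℝ) * (((N : ℝ) ^ (1 / (2 * α) + 1 / 4)) ^ (-α)) ^ 2
      = 4 * (N : ℝ) ^ (-(α / 2)) := by
    rw [hmul, hsq, mul_assoc, hone]
    congr 2; field_simp; ring
  have e5 : (N : ℝ) * ((N : ℝ) ^ (2 / α)) ^ (-α) = 1 * (N : ℝ) ^ (-1 : ℝ) := by
    rw [hmul, hone, one_mul]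
    congr 1; field_simp; ring
  have e6 : 4 * (N : ℝ) * ((c * (N : ℝ) ^ θ) ^ (-α)) ^ 2
      = 4 * (c ^ (-α)) ^ 2 * (N : ℝ) ^ (-(2 * α * θ - 1)) := by
    rw [Real.mul_rpow hc.le (hpow θ).le, mul_pow, hmul, hsq]
    have : -(2 * α * θ - 1) = 1 + θ * -α * 2 := by ring
    rw [this, ← hone]; ring
  rw [hW, e2] at b2
  rw [e3] at b3
  rw [e4] at b4
  rw [e5] at b5
  rw [e6] at b6
  refine le_trans (measure_mono ?_) ((measure_union_le _ _).trans (add_le_add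
    ((measure_union_le _ _).trans (add_le_add ((measure_union_le _ _).trans (add_le_add
    ((measure_union_le _ _).trans (add_le_add ((measure_union_le _ _).trans
    ((add_le_add b1.le b2).trans_eq (zero_add _))) b3)) b4)) b5)) b6))
  intro J hJ
  by_contra hno
  simp only [Set.mem_union, Set.mem_ofPred_eq, not_or, not_not, not_lt] at hno
  obtain ⟨⟨⟨⟨⟨h1, h2⟩, h3⟩, h4⟩, h5⟩, h6⟩ := hno
  exact hJ ⟨⟨h1, h2.trans_eq (by ring), h3, h4, h5⟩, h6⟩

end LevyGlass

theorem theorem3p1 (α β : ℝ) (hα0 : 0 < α) (hα1 : α < 1) (hβ : 0 < β) :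
    ∃ D : ℝ, 0 < D ∧
      ∀ a γ : ℝ, 0 < a → 1 / (2 * α) + 1 / (1 + α) < γ → γ < 1 / α →
        ∃ G : ∀ N : ℕ, Set (LevyGlass.Couplings N),
          (∀ N, MeasurableSet (G N)) ∧
          Tendsto (fun N => LevyGlass.disorderLaw α N (G N)) atTop (𝓝 1) ∧
          ∀ (N : ℕ) (J : LevyGlass.Couplings N), J ∈ G N →
            ∃ e : Fin (N.choose 2) ≃ LevyGlass.Bond N,
              (StrictAnti fun k => |J (e k)|) ∧
              (∀ b ∈ LevyGlass.largeBonds β a γ J, ∀ c ∈ LevyGlass.largeBonds β a γ J,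
                b ≠ c → LevyGlass.VertexDisjoint b c) ∧
              ∃ hK : (LevyGlass.largeBonds β a γ J).card < N.choose 2,
                ∀ (L : ℕ) (hL : L ≤ (LevyGlass.largeBonds β a γ J).card)
                  (η : LevyGlass.Config N),
                  LevyGlass.restrictedMixingTime β J (LevyGlass.topVertices e L) η ≤
                    ENNReal.ofReal (Real.exp
                      (2 * β * |J (e ⟨L, lt_of_le_of_lt hL hK⟩)| +
                        D * (N : ℝ) ^ (1 / 2 + 1 / (2 * α)))) := by
  have h1α : 0 < 1 - α := by linarith
  have hC : 0 < α / (1 - α) := by positivity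
  -- The light bonds contribute `α / (1 - α) + 1` to the coefficient of `4 β`, the removed bonds
  -- contribute `1`, and the final `3` absorbs the entropic factor `exp (3 N)`.
  refine ⟨4 * β * (α / (1 - α) + 2) + 3, by positivity, fun a γ ha hγ _ => ?_⟩
  have hγ' : 1 / (2 * α) < γ := by
    have : 0 < 1 / (1 + α) := by positivity
    linarith
  have hlim := LevyGlass.tendsto_disorderLaw_atypical hα0 hα1
    (c := a / (2 * β)) (by positivity) hγ'
  set T : ∀ N : ℕ, LevyGlass.Couplings N → Prop := fun N J =>
    LevyGlass.TypicalDisorder ((N : ℝ) ^ (1 / (2 * α)))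
        ((N : ℝ) ^ (1 / (2 * α) + 1 / 4)) ((N : ℝ) ^ (2 / α))
        ((α / (1 - α) + 1) * (N : ℝ) ^ (1 / 2 + 1 / (2 * α))) ((N : ℝ) ^ (1 / 4 : ℝ)) J
        ∧ LevyGlass.NoAdjacentAbove (a / (2 * β) * (N : ℝ) ^ γ) J with hT
  change Tendsto (fun N => LevyGlass.disorderLaw α N {J | ¬ T N J}) atTop (𝓝 0) at hlim
  set large : ℕ → Prop := fun N => 3 ≤ N ∧
    8 * (N : ℝ) ^ 2 * 4 ^ N * (2 + N + 2 * β * ((N : ℝ) ^ 2 * (N : ℝ) ^ (2 / α)))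
      ≤ Real.exp (3 * N) with hlarge
  have hev : ∀ᶠ N in atTop, large N := (eventually_ge_atTop 3).and
    (LevyGlass.eventually_poly_le_exp β (2 / α) hβ (by positivity))
  set B : ∀ N : ℕ, Set (LevyGlass.Couplings N) := fun N => {J | ¬ (large N ∧ T N J)} with hB
  -- Passing to a measurable hull of the bad event makes the good event measurable. For small `N`
  -- the bad event is everything.
  refine ⟨fun N => (toMeasurable (LevyGlass.disorderLaw α N) (B N))ᶜ,
    fun N => (measurableSet_toMeasurable _ _).compl, ?_, fun N J hJ => ?_⟩
  · have h1 : Tendsto (fun N => 1 - LevyGlass.disorderLaw α N {J | ¬ T N J}) atTop (𝓝 1) := by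
      simpa using ENNReal.Tendsto.sub (tendsto_const_nhds (x := (1 : ℝ≥0∞))) hlim
        (Or.inl ENNReal.one_ne_top)
    refine h1.congr' ?_
    filter_upwards [hev] with N hN
    have := LevyGlass.isProbabilityMeasure_disorderLaw hα0 (N := N) (by have := hN.1; omega)
    rw [prob_compl_eq_one_sub (measurableSet_toMeasurable _ _), measure_toMeasurable]
    simp only [hB, hN, true_and]
  · have hgood : large N ∧ T N J := by
      by_contra h
      exact hJ (subset_toMeasurable _ _ h)
    obtain ⟨⟨hN3, hpoly⟩, htyp, hno⟩ := hgood
    have hN1 : (1 : ℝ) ≤ N := by exact_mod_cast (by omega : 1 ≤ N)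
    have hN0 : (0 : ℝ) < N := by linarith
    obtain ⟨e, he⟩ := LevyGlass.exists_strictAnti_enumeration J htyp.injective
    have hdisj : ∀ b ∈ LevyGlass.largeBonds β a γ J, ∀ c ∈ LevyGlass.largeBonds β a γ J,
        b ≠ c → LevyGlass.VertexDisjoint b c := by
      intro b hb c hc hbc
      simp only [LevyGlass.largeBonds, Finset.mem_filter, Finset.mem_univ, true_and] at hb hc
      by_contra hd
      exact hno (b, c) (LevyGlass.mem_adjacentPairs.2 ⟨hbc, hd⟩) ⟨hb, hc⟩
    have hK := LevyGlass.card_largeBonds_lt hN3 hdisj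
    refine ⟨e, he, hdisj, hK, fun L hL η => ?_⟩
    have e1 : (N : ℝ) ^ (1 / 4 : ℝ) * (N : ℝ) ^ (1 / (2 * α) + 1 / 4)
        = (N : ℝ) ^ (1 / 2 + 1 / (2 * α)) := by
      rw [← Real.rpow_add hN0]; congr 1; ring
    have e2 : (N : ℝ) ≤ (N : ℝ) ^ (1 / 2 + 1 / (2 * α)) := by
      refine Real.self_le_rpow_of_one_le hN1 ?_
      have : 1 / 2 ≤ 1 / (2 * α) := one_div_le_one_div_of_le (by positivity) (by linarith)
      linarith
    refine LevyGlass.restrictedMixingTime_le_of_typical (κ := 1 / 2 + 1 / (2 * α)) htyp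
      (by omega) hβ (Real.rpow_nonneg hN0.le _) hpoly ?_ he ⟨L, lt_of_le_of_lt hL hK⟩ η
    rw [e1]
    linarith
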